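/- **Setting.** Let $f_0$ and $f_{\theta}$, $\theta\in\Theta=\{\theta_1,\dots,\theta_M\}$, be probability densities with respect to a common $\sigma$-finite measure, such that the Kullback–Leibler divergences $D(f_{\theta}\|f_0)$ and $D(f_0\|f_{\theta})$ are finite and positive for all $\theta\in\Theta$. Under $\mathbb P^{\theta}_{\gamma}$ the observations $X_1,X_2,\dots$ are independent, with density $f_0$ for $n<\gamma$ and $f_{\theta}$ for $n\ge\gamma$; under $\mathbb P_\infty$ all have density $f_0$. Put $L_\theta(x)=\log\frac{f_\theta(x)}{f_0(x)}$. Assume that some $\theta^*\in\Theta$ is least favorable: $\mathbb E^{\theta}_1[L_{\theta^*}(X_1)]=D(f_\theta\|f_0)-D(f_\theta\|f_{\theta^*})>0$ for all $\theta\in\Theta$. A policy $\Psi$ consists of controls $S_n\in\{0,1\}$, $n\ge1$ ($S_n=1$ iff $X_n$ is used), and a stopping time $\tau$, where $S_n$ is a measurable function of the information $\mathcal I_{n-1}$ given by those $X_k$, $k\le n-1$, with $S_k=1$ (and by which ones are absent), and $\tau$ is a stopping time for $(\mathcal I_n)$. The controls are defined for all $n$, also after $\tau$. Put $$\mathsf{FAR}(\Psi)=\frac1{\mathbb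 E_\infty[\tau]},\qquad \mathsf{PDC}(\Psi)=\limsup_{\gamma\to\infty}\mathbb E_\infty\Big[\frac1\gamma\sum_{n=1}^{\gamma-1}S_n\Big],$$ $$\mathsf{CADD}^\theta(\Psi)=\sup_{\gamma\ge1}\mathbb E^\theta_\gamma[\tau-\gamma\mid\tau\ge\gamma],\qquad \mathsf{WADD}^\theta(\Psi)=\sup_{\gamma\ge1}\operatorname{ess\,sup}\mathbb E^\theta_\gamma[(\tau-\gamma)^+\mid\mathcal I_{\gamma-1}].$$ Let $\mu>0$, $h\in[0,\infty]$ and a threshold $A$ be given. *DECuSum* (for $\theta^*$): $W_0=0$; if $W_{n-1}\ge0$ then $S_n=1$ and $W_n=\max\{W_{n-1}+L_{\theta^*}(X_n),-h\}$; if $W_{n-1}<0$ then $S_n=0$ and $W_n=\min\{0,W_{n-1}+\mu\}$; stop at $\tau_{\mathrm W}=\inf\{n\ge1:W_n\ge A\}$. *GCuSum*: $S_n=1$ for all $n$; stop at $\tau_{\mathrm{GC}}=\inf\{n\ge1:\max_{1\le k\le n}\max_{\theta\in\Theta}\sum_{i=k}^nL_\theta(X_i)\ge A\}$. *GDECuSum*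 (called *MDECuSum* when $\Theta$ is finite): the controls $S_n$ of DECuSum for $\theta^*$; stop at $\tau_{\mathrm{GD}}=\inf\{n\ge1:\max_{1\le k\le n}\max_{\theta\in\Theta}\sum_{i=k}^nS_iL_\theta(X_i)\ge A\}$. **Corollary 2.** For $0<\alpha<M$ set $A=A_\alpha=\log(M/\alpha)$ in all three algorithms. 1. For all $\mu>0$, $h\in[0,\infty]$ and $0<\alpha<M$, $$\mathsf{FAR}(\tau_{\mathrm{GD}})\le\mathsf{FAR}(\tau_{\mathrm{GC}})\le\alpha,\qquad \mathsf{PDC}(\tau_{\mathrm{GD}})=\mathsf{PDC}(\tau_{\mathrm W}).$$ 2. For all $\mu>0$, $h\in[0,\infty)$ and $k=1,\dots,M$, as $\alpha\to0$, $$\mathsf{WADD}^{\theta_k}(\tau_{\mathrm{GD}})\sim\mathsf{WADD}^{\theta_k}(\tau_{\mathrm{GC}})\sim\frac{|\log\alpha|}{D(f_{\theta_k}\|f_0)}.$$ 3. Let $0<\beta\le1$. There are $\mu>0$ and $h\in[0,\infty)$ such that $\mathsf{PDC}(\tau_{\mathrm W})\le\beta$ (for every threshold). For all such $\mu,h$ the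 GDECuSum algorithm is asymptotically optimal, uniformly over $\Theta$, for minimizing $\mathsf{CADD}^\theta$, and for minimizing $\mathsf{WADD}^\theta$, subject to $\mathsf{FAR}\le\alpha$ and $\mathsf{PDC}\le\beta$: it is a policy that satisfies both constraints for every $\alpha\in(0,1)$, and for every $\theta\in\Theta$ the ratio of its $\mathsf{CADD}^\theta$ (respectively $\mathsf{WADD}^\theta$) to the infimum over all policies that satisfy both constraints tends to $1$ as $\alpha\to0$. -/

import Mathlib

open MeasureTheory Filter Topology
open scoped ENNReal

namespace QCD

noncomputable section

/-! ### Observation model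

A sample path is a function `ω : ℕ → E`; the observation at time `n ≥ 1` is `X n ω = ω n`
(coordinate `0` is never observed). -/

/-- A pre-change probability density `f₀` and a family `f θ`, `θ ∈ Θ`, of post-change probability
densities with respect to a common sigma-finite measure `ref` on the observation space `E`. -/
structure ChangeModel (E : Type*) [MeasurableSpace E] (Θ : Type*) where
  ref : Measure E
  sigmaFinite_ref : SigmaFinite ref
  f₀ : E → ℝ
  f : Θ → E → ℝ
  measurable_f₀ : Measurable f₀
  measurable_f : ∀ θ, Measurable (f θ)
  nonneg_f₀ : ∀ x, 0 ≤ f₀ x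
  nonneg_f : ∀ θ x, 0 ≤ f θ x
  lintegral_f₀ : ∫⁻ x, ENNReal.ofReal (f₀ x) ∂ref = 1
  lintegral_f : ∀ θ, ∫⁻ x, ENNReal.ofReal (f θ x) ∂ref = 1

/-- A (not necessarily causal) pair of an observation control and a stopping rule: `used n` is the
event `{S n = 1}` that `X n` is used for decision making (for `n ≥ 1`), and `τ` is the time at which
a change is declared. The control `S n` is defined for all `n`, also after `τ`. -/
structure Policy (E : Type*) where
  used : ℕ → Set (ℕ → E)
  τ : (ℕ → E) → ℕ∞

section Information

variable {E : Type*}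

open Classical in
/-- The observation `X n` if it is used, and the symbol `Sum.inr ()` if it is absent. -/
def obs (used : ℕ → Set (ℕ → E)) (n : ℕ) (ω : ℕ → E) : E ⊕ Unit :=
  if ω ∈ used n then Sum.inl (ω n) else Sum.inr ()

/-- The sigma-algebra of the information `I n` available at time `n`, generated by the
observations `X 1, …, X n` that are used. -/
abbrev info [MeasurableSpace E] (used : ℕ → Set (ℕ → E)) (n : ℕ) : MeasurableSpace (ℕ → E) :=
  ⨆ k ∈ Finset.Icc 1 n, MeasurableSpace.comap (obs used k) inferInstance

/-- Control policies: `S (n + 1)` is a measurable function of the information `I n`, and `τ` is a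
stopping time for `(I n)`. -/
structure Policy.Admissible [MeasurableSpace E] (Ψ : Policy E) : Prop where
  measurableSet_used : ∀ n, MeasurableSet[info Ψ.used n] (Ψ.used (n + 1))
  measurableSet_stop : ∀ n : ℕ, MeasurableSet[info Ψ.used n] {ω | Ψ.τ ω ≤ n}

end Information

/-- `inf {n ≥ 1 : Y n ≥ A}`, with value `∞` if there is no such `n`. -/
def firstPassage {Ω : Type*} (Y : ℕ → Ω → ℝ) (A : ℝ) (ω : Ω) : ℕ∞ :=
  ⨅ (n : ℕ) (_ : 1 ≤ n ∧ A ≤ Y n ω), (n : ℕ∞)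

/-- The truncation `(x)^{h+} = max {x, -h}`, for `h ∈ [0, ∞]`. -/
def truncBelow (h : ℝ≥0∞) (x : ℝ) : ℝ :=
  if h = ∞ then x else max x (-h.toReal)

/-- `u ~ v` along the filter `l`: the quotient `u / v` tends to `1`. -/
def AsympEq {ι : Type*} (l : Filter ι) (u v : ι → ℝ≥0∞) : Prop :=
  Tendsto (fun i => u i / v i) l (𝓝 1)

namespace ChangeModel

variable {E : Type*} [MeasurableSpace E] {Θ : Type*} (m : ChangeModel E Θ)

/-- The pre-change law of one observation. -/
def P₀ : Measure E := m.ref.withDensity fun x => ENNReal.ofReal (m.f₀ x)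

/-- The law of one observation after the change, when the post-change parameter is `θ`. -/
def P (θ : Θ) : Measure E := m.ref.withDensity fun x => ENNReal.ofReal (m.f θ x)

/-- The law of the observations when the change never occurs. -/
def pathInf : Measure (ℕ → E) := Measure.infinitePi fun _ => m.P₀

/-- The law of the observations when the change point is `γ` and the post-change parameter is `θ`:
independent, with density `f₀` before time `γ` and `f θ` from time `γ` on. -/
def path (θ : Θ) (γ : ℕ) : Measure (ℕ → E) :=
  Measure.infinitePi fun n => if n < γ then m.P₀ else m.P θ

/-- The log likelihood ratio `log (f θ x / f₀ x)`. -/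
def llr (θ : Θ) (x : E) : ℝ := Real.log (m.f θ x / m.f₀ x)

/-- The Kullback-Leibler divergence `D(f θ || f₀)`. -/
def D (θ : Θ) : ℝ≥0∞ := InformationTheory.klDiv (m.P θ) m.P₀

/-- The Kullback-Leibler divergence `D(f₀ || f θ)`. -/
def D' (θ : Θ) : ℝ≥0∞ := InformationTheory.klDiv m.P₀ (m.P θ)

/-- `θs` is least favorable: the log likelihood ratio of `f θs` and `f₀` has positive mean under
every post-change law. (A Bochner integral that is positive is the integral of an integrable
function.) -/
def LeastFavorable (θs : Θ) : Prop := ∀ θ, 0 < ∫ x, m.llr θs x ∂(m.P θ)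

/-! ### Performance metrics -/

/-- `FAR(Ψ) = 1 / E_∞[τ]`. -/
def FAR (Ψ : Policy E) : ℝ≥0∞ := (∫⁻ ω, (Ψ.τ ω : ℝ≥0∞) ∂m.pathInf)⁻¹

/-- `PDC(Ψ) = limsup_{γ → ∞} E_∞[(1 / γ) ∑_{n = 1}^{γ - 1} S n]`. -/
def PDC (Ψ : Policy E) : ℝ≥0∞ :=
  limsup (fun γ : ℕ => ∫⁻ ω, (∑ n ∈ Finset.Ico 1 γ, (Ψ.used n).indicator 1 ω) / (γ : ℝ≥0∞)
    ∂m.pathInf) atTop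

/-- `CADD^θ(Ψ) = sup_{γ ≥ 1} E^θ_γ[τ - γ | τ ≥ γ]`; those `γ` for which `τ ≥ γ` has probability `0`
do not contribute. -/
def CADD (θ : Θ) (Ψ : Policy E) : ℝ≥0∞ :=
  ⨆ (γ : ℕ) (_ : 1 ≤ γ), ∫⁻ ω, ((Ψ.τ ω : ℝ≥0∞) - (γ : ℝ≥0∞))
    ∂(ProbabilityTheory.cond (m.path θ γ) {ω | (γ : ℕ∞) ≤ Ψ.τ ω})

/-- `WADD^θ(Ψ) = sup_{γ ≥ 1} ess sup E^θ_γ[(τ - γ)^+ | I (γ - 1)]`. Subtraction in `[0, ∞]` is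
truncated at `0`. -/
def WADD (θ : Θ) (Ψ : Policy E) : ℝ≥0∞ :=
  ⨆ (γ : ℕ) (_ : 1 ≤ γ), essSup
    (condLExp (info Ψ.used (γ - 1)) (m.path θ γ)
      fun ω => (Ψ.τ ω : ℝ≥0∞) - (γ : ℝ≥0∞))
    (m.path θ γ)

/-- The policies that satisfy the constraints `FAR ≤ α` and `PDC ≤ β`. -/
def feasible (α β : ℝ) : Set (Policy E) :=
  {Ψ | Ψ.Admissible ∧ m.FAR Ψ ≤ ENNReal.ofReal α ∧ m.PDC Ψ ≤ ENNReal.ofReal β}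

/-- The policies `Ψ α` are asymptotically optimal as `α → 0`, uniformly in the post-change
parameter, for minimizing the delay metric `J` subject to `FAR ≤ α` and `PDC ≤ β`: each `Ψ α` is
feasible, and for every `θ` the quotient of `J θ (Ψ α)` and the optimal value tends to `1`. -/
def AsympOptimal (J : Θ → Policy E → ℝ≥0∞) (β : ℝ) (Ψ : ℝ → Policy E) : Prop :=
  (∀ α, 0 < α → α < 1 → Ψ α ∈ m.feasible α β) ∧
  ∀ θ, AsympEq (𝓝[>] 0) (fun α => J θ (Ψ α)) fun α => ⨅ Φ ∈ m.feasible α β, J θ Φ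

/-! ### The algorithms -/

open Classical in
/-- `log (f θ (X n) / f₀ (X n))` if `X n` is used, and `0` otherwise. -/
def usedLLR (used : ℕ → Set (ℕ → E)) (θ : Θ) (n : ℕ) (ω : ℕ → E) : ℝ :=
  if ω ∈ used n then m.llr θ (ω n) else 0

/-- The generalized likelihood ratio statistic
`max_{1 ≤ k ≤ n} sup_θ ∑_{i = k}^n log (f θ (X i) / f₀ (X i))` (`n ≥ 1`), in which the observations
that are not used contribute `0`. -/
def glr (used : ℕ → Set (ℕ → E)) (n : ℕ) (ω : ℕ → E) : ℝ :=
  ⨆ k : Set.Icc 1 n, ⨆ θ : Θ, ∑ i ∈ Finset.Icc (k : ℕ) n, m.usedLLR used θ i ω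

/-- The GCuSum algorithm with threshold `A`: all observations are used. -/
def GCuSum (A : ℝ) : Policy E where
  used := fun _ => Set.univ
  τ := firstPassage (m.glr fun _ => Set.univ) A

open Classical in
/-- The DECuSum statistic `W n` for the parameter `θ`. -/
def W (θ : Θ) (μ : ℝ) (h : ℝ≥0∞) : ℕ → (ℕ → E) → ℝ
  | 0, _ => 0
  | n + 1, ω =>
    if 0 ≤ W θ μ h n ω then truncBelow h (W θ μ h n ω + m.llr θ (ω (n + 1)))
    else min 0 (W θ μ h n ω + μ)

/-- The observation control of the DECuSum algorithm: `X n` is used iff `W (n - 1) ≥ 0`. -/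
def deUsed (θ : Θ) (μ : ℝ) (h : ℝ≥0∞) (n : ℕ) : Set (ℕ → E) := {ω | 0 ≤ m.W θ μ h (n - 1) ω}

/-- The DECuSum algorithm for the parameter `θ` with threshold `A`. -/
def DECuSum (θ : Θ) (μ : ℝ) (h : ℝ≥0∞) (A : ℝ) : Policy E where
  used := m.deUsed θ μ h
  τ := firstPassage (m.W θ μ h) A

/-- The GDECuSum algorithm with threshold `A`: the observation control is that of the DECuSum
algorithm for the parameter `θs`, and a change is declared when the generalized likelihood ratio
statistic of the observations that are used reaches `A`. -/
def GDECuSum (θs : Θ) (μ : ℝ) (h : ℝ≥0∞) (A : ℝ) : Policy E where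
  used := m.deUsed θs μ h
  τ := firstPassage (m.glr (m.deUsed θs μ h)) A

end ChangeModel

end

end QCD

/-!
# Asymptotic optimality of data-efficient quickest change detection

Under every law considered here the observations are independent, so a process that is built
recursively from the past is a Markov chain with explicit one-step transitions (`lintegral_step`,
`setLIntegral_step`). Most estimates below are one-step (super)martingale inequalities, summed
along the path. GCuSum is GDECuSum with truncation `h = 0` (`GCuSum_eq_GDECuSum`), so that only GDECuSum
needs an upper bound for the delay.

*False alarms.* Before the change, `∑_θ R_n θ - M n` is a martingale, with `R` the
Shiryaev-Roberts statistic; since `∑_θ R_n θ ≥ e ^ A` at an alarm of GCuSum, the mean time to a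
false alarm is at least `e ^ A / M = 1 / α` (`exp_le_card_mul_lintegral_tau`). An observation that
is skipped does not change the CuSum statistics, so the statistics of GDECuSum are those of GCuSum
run on a slower clock (`lintegral_alive_survival`).

*Delay, upper bound.* After the change, whatever the past, at most `(A + c) / E[min (L_θ) c]` used
observations are needed on average to bring the log likelihood ratio above `A` (Wald's inequality,
`wald_step`). Only a bounded number of observations is skipped on average (`skipBound`): each
undershoot of the DECuSum statistic costs at most `h / μ + 1` skips, and the expected number of
undershoots is finite because the increments have positive drift under every post-change law. That
number is represented, by time reversal, through the random walk killed when it becomes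
nonnegative (`undershoots`); the representation is verified with Fubini's theorem. Letting `A → ∞`
and then `c → ∞` gives `|log α| / D(f_θ‖f₀)` to first order.

*Delay, lower bound.* A stopping time `τ` with mean at least `1 / α` under the pre-change law
satisfies, for some `γ`, `τ ≥ γ + k` with conditional probability close to `1` given `τ ≥ γ`, as
long as `k α` is small (`exists_survival_block`). For `k` slightly below `|log α| / D(f_θ‖f₀)` a
change of measure transfers this to the law with change point `γ`, since by the law of large
numbers the log likelihood ratio of the `k` observations is unlikely to exceed `(1 + a) k
D(f_θ‖f₀)` (`le_CADD`). As `CADD ≤ WADD`, both bounds apply to both metrics.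

*Duty cycle.* Before the change `W + h` decreases by at least `d = -E[max L (-h)]` on average when
an observation is used and increases by at most `μ` when it is skipped; hence the duty cycle is at
most `μ / d`, where `d > 0` for large `h`, and `μ` may be chosen small (`exists_PDC_DECuSum_le`).
-/

namespace QCD

/-! ### Independent observations -/

section Past

variable {E : Type*} [MeasurableSpace E]

/-- The sigma-algebra generated by the observations `X 1, …, X n`. -/
abbrev past (n : ℕ) : MeasurableSpace (ℕ → E) :=
  ⨆ k ∈ Finset.Icc 1 n, MeasurableSpace.comap (fun ω => ω k) inferInstance

theorem past_le (n : ℕ) : past (E := E) n ≤ MeasurableSpace.pi :=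
  iSup₂_le fun k _ => (measurable_pi_apply k).comap_le

theorem past_mono {n n' : ℕ} (h : n ≤ n') : past (E := E) n ≤ past n' :=
  biSup_mono fun _ hk => Finset.Icc_subset_Icc_right h hk

theorem measurable_past_eval {n k : ℕ} (h₁ : 1 ≤ k) (h₂ : k ≤ n) :
    Measurable[past n] fun ω : ℕ → E => ω k :=
  measurable_iff_comap_le.2
    (le_iSup₂ (f := fun k (_ : k ∈ Finset.Icc 1 n) =>
      MeasurableSpace.comap (fun ω : ℕ → E => ω k) inferInstance) k (Finset.mem_Icc.2 ⟨h₁, h₂⟩))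

theorem past_eq_comap (n : ℕ) :
    past (E := E) n = MeasurableSpace.comap (Finset.Icc 1 n).restrict MeasurableSpace.pi := by
  apply le_antisymm
  · refine iSup₂_le fun k hk => ?_
    rintro _ ⟨t, ht, rfl⟩
    exact ⟨(fun y => y ⟨k, hk⟩) ⁻¹' t, measurable_pi_apply _ ht, rfl⟩
  · rw [← measurable_iff_comap_le]
    refine @measurable_pi_lambda _ _ _ (past n) _ _ fun k => ?_
    exact measurable_past_eval (Finset.mem_Icc.1 k.2).1 (Finset.mem_Icc.1 k.2).2

/-- The state of a process at time `n`, built from the first `n` observations, is independent of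
the next observation. -/
theorem lintegral_step (ν : ℕ → Measure E) [∀ i, IsProbabilityMeasure (ν i)] {S : Type*}
    [MeasurableSpace S] {n : ℕ} {Z : (ℕ → E) → S} (hZ : Measurable[past n] Z)
    {g : S → E → ℝ≥0∞} (hg : Measurable (Function.uncurry g)) :
    ∫⁻ ω, g (Z ω) (ω (n + 1)) ∂Measure.infinitePi ν
      = ∫⁻ ω, ∫⁻ x, g (Z ω) x ∂ν (n + 1) ∂Measure.infinitePi ν := by
  have hI : ProbabilityTheory.iIndepFun (fun (i : ℕ) (ω : ℕ → E) => ω i)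
      (Measure.infinitePi ν) :=
    ProbabilityTheory.iIndepFun_infinitePi (X := fun _ x => x) fun _ => measurable_id
  have h1 := ProbabilityTheory.indep_iSup_of_disjoint
    (m := fun k => MeasurableSpace.comap (fun ω : ℕ → E => ω k) inferInstance)
    (S := {k | k ∈ Finset.Icc 1 n}) (T := {n + 1})
    (fun i => (measurable_pi_apply i).comap_le) hI (by
      rw [Set.disjoint_singleton_right]; simp)
  have hZ' : Measurable Z := hZ.mono (past_le n) le_rfl
  have h2 : ProbabilityTheory.IndepFun Z (fun ω : ℕ → E => ω (n + 1)) (Measure.infinitePi ν) := by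
    rw [ProbabilityTheory.IndepFun_iff_Indep]
    refine ProbabilityTheory.indep_of_indep_of_le_right
      (ProbabilityTheory.indep_of_indep_of_le_left h1 hZ.comap_le) ?_
    exact le_iSup₂ (f := fun k (_ : k ∈ ({n + 1} : Set ℕ)) =>
      MeasurableSpace.comap (fun ω : ℕ → E => ω k) inferInstance) (n + 1) rfl
  have h3 := (ProbabilityTheory.indepFun_iff_map_prod_eq_prod_map_map hZ'.aemeasurable
    (measurable_pi_apply (n + 1)).aemeasurable).1 h2
  rw [Measure.infinitePi_map_eval] at h3
  calc ∫⁻ ω, g (Z ω) (ω (n + 1)) ∂Measure.infinitePi ν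
      = ∫⁻ z, Function.uncurry g z
          ∂((Measure.infinitePi ν).map fun ω => (Z ω, ω (n + 1))) := by
        rw [lintegral_map hg (by fun_prop)]; rfl
    _ = _ := by
        rw [h3, lintegral_prod _ hg.aemeasurable, lintegral_map _ hZ']
        · rfl
        · exact hg.lintegral_prod_right'

theorem setLIntegral_step (ν : ℕ → Measure E) [∀ i, IsProbabilityMeasure (ν i)] {S : Type*}
    [MeasurableSpace S] {n : ℕ} {B : Set (ℕ → E)} (hB : MeasurableSet[past n] B)
    {Z : (ℕ → E) → S} (hZ : Measurable[past n] Z)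
    {g : S → E → ℝ≥0∞} (hg : Measurable (Function.uncurry g)) :
    ∫⁻ ω in B, g (Z ω) (ω (n + 1)) ∂Measure.infinitePi ν
      = ∫⁻ ω in B, ∫⁻ x, g (Z ω) x ∂ν (n + 1) ∂Measure.infinitePi ν := by
  have hB' := past_le n _ hB
  have hZB : Measurable[past n] fun ω : ℕ → E => (B.indicator (1 : (ℕ → E) → ℝ≥0∞) ω, Z ω) := by
    let _ := past (E := E) n
    exact (measurable_one.indicator hB).prodMk hZ
  have hg' : Measurable (Function.uncurry fun (z : ℝ≥0∞ × S) (x : E) => z.1 * g z.2 x) := by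
    have e : (Function.uncurry fun (z : ℝ≥0∞ × S) (x : E) => z.1 * g z.2 x)
        = fun q => q.1.1 * Function.uncurry g (q.1.2, q.2) := rfl
    rw [e]
    fun_prop
  have h := lintegral_step ν hZB hg'
  rw [← lintegral_indicator hB', ← lintegral_indicator hB']
  refine (lintegral_congr fun ω => ?_).trans (h.trans (lintegral_congr fun ω => ?_))
  · by_cases hω : ω ∈ B <;> simp [hω]
  · by_cases hω : ω ∈ B <;> simp [hω]

theorem trim_infinitePi_congr (ν ν' : ℕ → Measure E) [∀ i, IsProbabilityMeasure (ν i)]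
    [∀ i, IsProbabilityMeasure (ν' i)] {n : ℕ} (h : ∀ k, 1 ≤ k → k ≤ n → ν k = ν' k) :
    (Measure.infinitePi ν).trim (past_le n) = (Measure.infinitePi ν').trim (past_le n) := by
  refine @Measure.ext _ (past n) _ _ fun B hB => ?_
  rw [trim_measurableSet_eq _ hB, trim_measurableSet_eq _ hB]
  rw [past_eq_comap] at hB
  obtain ⟨t, ht, rfl⟩ := hB
  have e : (fun i : Finset.Icc 1 n => ν i) = fun i : Finset.Icc 1 n => ν' i :=
    funext fun k => h k (Finset.mem_Icc.1 k.2).1 (Finset.mem_Icc.1 k.2).2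
  rw [← Measure.map_apply (by fun_prop) ht, ← Measure.map_apply (by fun_prop) ht,
    Measure.infinitePi_map_restrict, Measure.infinitePi_map_restrict]
  congr 1
  simp only [e]

theorem measure_infinitePi_congr (ν ν' : ℕ → Measure E) [∀ i, IsProbabilityMeasure (ν i)]
    [∀ i, IsProbabilityMeasure (ν' i)] {n : ℕ} (h : ∀ k, 1 ≤ k → k ≤ n → ν k = ν' k)
    {B : Set (ℕ → E)} (hB : MeasurableSet[past n] B) :
    Measure.infinitePi ν B = Measure.infinitePi ν' B := by
  rw [← trim_measurableSet_eq (past_le n) hB, ← trim_measurableSet_eq (past_le n) hB,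
    trim_infinitePi_congr ν ν' h]

/-- Changing finitely many marginals of a product measure by densities multiplies the product
measure by the product of these densities. -/
theorem infinitePi_withDensity (P : Measure E) [IsProbabilityMeasure P] (r : E → ℝ≥0∞)
    (hr : Measurable r) [IsProbabilityMeasure (P.withDensity r)] (I : Finset ℕ) :
    (Measure.infinitePi fun _ : ℕ => P).withDensity (fun ω => ∏ i ∈ I, r (ω i))
      = Measure.infinitePi fun i => if i ∈ I then P.withDensity r else P := by
  classical
  have inst : ∀ i, IsProbabilityMeasure (if i ∈ I then P.withDensity r else P) := fun i => by
    split_ifs <;> infer_instance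
  refine Measure.eq_infinitePi _ fun s t ht => ?_
  have hst : MeasurableSet ((s : Set ℕ).pi t) := .pi s.countable_toSet fun i _ => ht i
  rw [withDensity_apply _ hst, ← lintegral_indicator hst]
  set g : ℕ → E → ℝ≥0∞ := fun i x =>
    (if i ∈ I then r x else 1) * (if i ∈ s then (t i).indicator 1 x else 1) with hg
  have hgm : ∀ i, Measurable (g i) := by
    intro i
    simp only [hg]
    have := (measurable_one (α := ℝ≥0∞)).indicator (ht i)
    split_ifs <;> fun_prop
  have e : ∀ ω : ℕ → E, ((s : Set ℕ).pi t).indicator (fun ω => ∏ i ∈ I, r (ω i)) ω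
      = ∏ i ∈ I ∪ s, g i (ω i) := by
    intro ω
    simp only [hg, Finset.prod_mul_distrib]
    have h1 : ∏ i ∈ I ∪ s, (if i ∈ I then r (ω i) else 1) = ∏ i ∈ I, r (ω i) := by
      rw [Finset.prod_ite_mem, Finset.inter_eq_right.2 Finset.subset_union_left]
    have h2 : ∏ i ∈ I ∪ s, (if i ∈ s then (t i).indicator 1 (ω i) else 1)
        = ∏ i ∈ s, (t i).indicator (1 : E → ℝ≥0∞) (ω i) := by
      rw [Finset.prod_ite_mem, Finset.inter_eq_right.2 Finset.subset_union_right]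
    rw [h1, h2]
    by_cases hω : ω ∈ (s : Set ℕ).pi t
    · rw [Set.indicator_of_mem hω, Finset.prod_eq_one (s := s) fun i hi => ?_, mul_one]
      rw [Set.indicator_of_mem (hω i hi)]; rfl
    · rw [Set.indicator_of_notMem hω]
      simp only [Set.mem_pi, not_forall] at hω
      obtain ⟨i, hi, hit⟩ := hω
      rw [Finset.prod_eq_zero (i := i) hi (Set.indicator_of_notMem hit _), mul_zero]
  have hI : ProbabilityTheory.iIndepFun (fun (i : ℕ) (ω : ℕ → E) => g i (ω i))
      (Measure.infinitePi fun _ : ℕ => P) :=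
    ProbabilityTheory.iIndepFun_infinitePi hgm
  simp only [e]
  rw [ProbabilityTheory.lintegral_prod_eq_prod_lintegral_of_indepFun _
    (fun (i : ℕ) (ω : ℕ → E) => g i (ω i)) hI fun i => (hgm i).comp (measurable_pi_apply i)]
  have e2 : ∀ i, ∫⁻ ω, g i (ω i) ∂(Measure.infinitePi fun _ : ℕ => P) = ∫⁻ x, g i x ∂P := by
    intro i
    rw [← lintegral_map (hgm i) (measurable_pi_apply i),
      Measure.infinitePi_map_eval (fun _ : ℕ => P) i]
  simp only [e2]
  have e3 : ∀ i, ∫⁻ x, g i x ∂P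
      = if i ∈ s then (if i ∈ I then P.withDensity r else P) (t i) else 1 := by
    intro i
    by_cases h1 : i ∈ s <;> by_cases h2 : i ∈ I <;> simp only [hg, h1, h2, if_true, if_false]
    · rw [withDensity_apply _ (ht i), ← lintegral_indicator (ht i)]
      congr 1
      ext x
      by_cases hx : x ∈ t i <;> simp [hx]
    · simp [lintegral_indicator (ht i)]
    · have := measure_univ (μ := P.withDensity r)
      rw [withDensity_apply _ .univ] at this
      simpa using this
    · simp
  simp only [e3]
  rw [Finset.prod_ite_mem, Finset.inter_eq_right.2 Finset.subset_union_right]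

end Past

/-! ### Likelihood ratios and divergences -/

namespace ChangeModel

variable {E : Type*} [MeasurableSpace E] {Θ : Type*} (m : ChangeModel E Θ)

instance isProbabilityMeasure_P₀ : IsProbabilityMeasure m.P₀ :=
  ⟨by rw [P₀, withDensity_apply _ .univ, Measure.restrict_univ, m.lintegral_f₀]⟩

instance isProbabilityMeasure_P (θ : Θ) : IsProbabilityMeasure (m.P θ) :=
  ⟨by rw [P, withDensity_apply _ .univ, Measure.restrict_univ, m.lintegral_f θ]⟩

instance isProbabilityMeasure_ite (θ : Θ) (γ i : ℕ) :
    IsProbabilityMeasure (if i < γ then m.P₀ else m.P θ) := by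
  split_ifs <;> infer_instance

instance isProbabilityMeasure_pathInf : IsProbabilityMeasure m.pathInf :=
  inferInstanceAs (IsProbabilityMeasure (Measure.infinitePi fun _ => m.P₀))

instance isProbabilityMeasure_path (θ : Θ) (γ : ℕ) : IsProbabilityMeasure (m.path θ γ) :=
  inferInstanceAs
    (IsProbabilityMeasure (Measure.infinitePi fun n => if n < γ then m.P₀ else m.P θ))

theorem measurable_llr (θ : Θ) : Measurable (m.llr θ) :=
  ((m.measurable_f θ).div m.measurable_f₀).log

theorem P_absolutelyContinuous {θ : Θ} (h : m.D θ < ∞) : m.P θ ≪ m.P₀ :=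
  (InformationTheory.klDiv_ne_top_iff.1 h.ne).1

theorem P₀_absolutelyContinuous {θ : Θ} (h : m.D' θ < ∞) : m.P₀ ≪ m.P θ :=
  (InformationTheory.klDiv_ne_top_iff.1 h.ne).1

theorem P_eq_withDensity_div {θ : Θ} (h : m.D θ < ∞) :
    m.P θ = m.P₀.withDensity fun x => ENNReal.ofReal (m.f θ x / m.f₀ x) := by
  have hm₀ := m.measurable_f₀
  have hm := m.measurable_f θ
  rw [P₀, ← withDensity_mul _ (by fun_prop) (by fun_prop), P]
  refine withDensity_congr_ae ?_
  -- `f θ` vanishes a.e. where `f₀` does, so that the junk value of the quotient does no harm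
  have hs : MeasurableSet {x | m.f₀ x = 0} := hm₀ (measurableSet_singleton 0)
  have h0 : m.P₀ {x | m.f₀ x = 0} = 0 := by
    rw [P₀, withDensity_apply _ hs]
    refine (setLIntegral_congr_fun hs fun x hx => ?_).trans lintegral_zero
    simp only [Set.mem_ofPred_eq] at hx
    simp [hx]
  have h1 := m.P_absolutelyContinuous h h0
  rw [P, withDensity_apply _ hs, setLIntegral_eq_zero_iff hs (by fun_prop)] at h1
  filter_upwards [h1] with x hx
  simp only [Pi.mul_apply]
  rw [← ENNReal.ofReal_mul (m.nonneg_f₀ x)]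
  by_cases hx0 : m.f₀ x = 0
  · rw [hx hx0, hx0]; simp
  · rw [mul_div_cancel₀ _ hx0]

theorem llr_ae_eq {θ : Θ} (h : m.D θ < ∞) : m.llr θ =ᵐ[m.P₀] MeasureTheory.llr (m.P θ) m.P₀ := by
  have hm₀ := m.measurable_f₀
  have hm := m.measurable_f θ
  have h1 := Measure.rnDeriv_withDensity m.P₀
    (f := fun x => ENNReal.ofReal (m.f θ x / m.f₀ x)) (by fun_prop)
  rw [← m.P_eq_withDensity_div h] at h1
  filter_upwards [h1] with x hx
  rw [MeasureTheory.llr, hx, ENNReal.toReal_ofReal (div_nonneg (m.nonneg_f θ x) (m.nonneg_f₀ x)),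
    llr]

theorem P_eq_withDensity_exp {θ : Θ} (h : m.D θ < ∞) (h' : m.D' θ < ∞) :
    m.P θ = m.P₀.withDensity fun x => ENNReal.ofReal (Real.exp (m.llr θ x)) := by
  have hm₀ := m.measurable_f₀
  have hm := m.measurable_f θ
  have e := m.P_eq_withDensity_div h
  have h1 : m.P θ {x | m.f θ x / m.f₀ x = 0} = 0 := by
    have hs : MeasurableSet {x | m.f θ x / m.f₀ x = 0} :=
      (hm.div hm₀) (measurableSet_singleton 0)
    rw [e, withDensity_apply _ hs]
    refine (setLIntegral_congr_fun hs fun x hx => ?_).trans lintegral_zero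
    simp only [Set.mem_ofPred_eq] at hx
    simp [hx]
  have h2 : ∀ᵐ x ∂m.P₀, m.f θ x / m.f₀ x ≠ 0 :=
    (m.P₀_absolutelyContinuous h').ae_le (measure_eq_zero_iff_ae_notMem.1 h1)
  rw [e]
  refine withDensity_congr_ae ?_
  filter_upwards [h2] with x hx
  rw [llr, Real.exp_log ((div_nonneg (m.nonneg_f θ x) (m.nonneg_f₀ x)).lt_of_ne' hx)]

theorem lintegral_exp_llr {θ : Θ} (h : m.D θ < ∞) (h' : m.D' θ < ∞) :
    ∫⁻ x, ENNReal.ofReal (Real.exp (m.llr θ x)) ∂m.P₀ = 1 := by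
  have h1 := measure_univ (μ := m.P θ)
  rwa [m.P_eq_withDensity_exp h h', withDensity_apply _ .univ, Measure.restrict_univ] at h1

theorem integrable_llr {θ : Θ} (h : m.D θ < ∞) : Integrable (m.llr θ) (m.P θ) :=
  (integrable_congr ((m.P_absolutelyContinuous h).ae_eq (m.llr_ae_eq h))).2
    (InformationTheory.klDiv_ne_top_iff.1 h.ne).2

theorem integral_llr {θ : Θ} (h : m.D θ < ∞) :
    ∫ x, m.llr θ x ∂(m.P θ) = (m.D θ).toReal := by
  rw [D, InformationTheory.toReal_klDiv_of_measure_eq (m.P_absolutelyContinuous h) (by simp)]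
  exact integral_congr_ae ((m.P_absolutelyContinuous h).ae_eq (m.llr_ae_eq h))

theorem llr_ae_eq_neg {θ : Θ} (h : m.D θ < ∞) (h' : m.D' θ < ∞) :
    m.llr θ =ᵐ[m.P₀] -MeasureTheory.llr m.P₀ (m.P θ) :=
  (m.llr_ae_eq h).trans (neg_llr (m.P₀_absolutelyContinuous h')).symm

theorem integrable_llr_P₀ {θ : Θ} (h : m.D θ < ∞) (h' : m.D' θ < ∞) :
    Integrable (m.llr θ) m.P₀ :=
  (integrable_congr (m.llr_ae_eq_neg h h')).2 (InformationTheory.klDiv_ne_top_iff.1 h'.ne).2.neg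

theorem integral_llr_P₀ {θ : Θ} (h : m.D θ < ∞) (h' : m.D' θ < ∞) :
    ∫ x, m.llr θ x ∂m.P₀ = -(m.D' θ).toReal := by
  rw [D', InformationTheory.toReal_klDiv_of_measure_eq (m.P₀_absolutelyContinuous h') (by simp),
    integral_congr_ae (m.llr_ae_eq_neg h h')]
  exact integral_neg _

end ChangeModel

/-! ### Information, stopping times and admissibility -/

section Information

variable {E : Type*}

theorem firstPassage_le_iff {Ω : Type*} {Y : ℕ → Ω → ℝ} {A : ℝ} {ω : Ω} {n : ℕ} :
    firstPassage Y A ω ≤ n ↔ ∃ j, 1 ≤ j ∧ j ≤ n ∧ A ≤ Y j ω := by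
  constructor
  · intro h
    by_contra! hc
    have h1 : ((n + 1 : ℕ) : ℕ∞) ≤ firstPassage Y A ω :=
      le_iInf₂ fun j hj => by
        by_contra! hlt
        exact absurd hj.2 (not_le.2 (hc j hj.1 (Nat.lt_succ_iff.1 (by exact_mod_cast hlt))))
    have h2 : ((n + 1 : ℕ) : ℕ∞) ≤ (n : ℕ) := h1.trans h
    have h3 : n + 1 ≤ n := by exact_mod_cast h2
    omega
  · rintro ⟨j, h1, h2, h3⟩
    exact (iInf₂_le j ⟨h1, h3⟩).trans (by exact_mod_cast h2)

theorem lt_firstPassage_iff {Ω : Type*} {Y : ℕ → Ω → ℝ} {A : ℝ} {ω : Ω} {n : ℕ} :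
    (n : ℕ∞) < firstPassage Y A ω ↔ ∀ j, 1 ≤ j → j ≤ n → Y j ω < A := by
  rw [← not_le, firstPassage_le_iff]
  push Not
  rfl

variable [MeasurableSpace E]

theorem info_mono (used : ℕ → Set (ℕ → E)) {n n' : ℕ} (h : n ≤ n') :
    info used n ≤ info used n' :=
  biSup_mono fun _ hk => Finset.Icc_subset_Icc_right h hk

theorem measurable_info_obs (used : ℕ → Set (ℕ → E)) {n k : ℕ} (h₁ : 1 ≤ k) (h₂ : k ≤ n) :
    Measurable[info used n] (obs used k) :=
  measurable_iff_comap_le.2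
    (le_iSup₂ (f := fun k (_ : k ∈ Finset.Icc 1 n) =>
      MeasurableSpace.comap (obs used k) inferInstance) k (Finset.mem_Icc.2 ⟨h₁, h₂⟩))

theorem info_le_past {used : ℕ → Set (ℕ → E)}
    (h : ∀ n, MeasurableSet[info used n] (used (n + 1))) (n : ℕ) : info used n ≤ past n := by
  induction n with
  | zero => simp
  | succ n ih =>
    refine iSup₂_le fun k hk => ?_
    obtain ⟨hk1, hk2⟩ := Finset.mem_Icc.1 hk
    obtain ⟨k, rfl⟩ : ∃ j, k = j + 1 := ⟨k - 1, by omega⟩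
    rw [← measurable_iff_comap_le]
    have hu : MeasurableSet[past (n + 1)] (used (k + 1)) :=
      past_mono (Nat.le_succ n) _ (ih _ (info_mono used (Nat.le_of_succ_le_succ hk2) _ (h k)))
    have he := measurable_past_eval (E := E) hk1 hk2
    let _ := past (E := E) (n + 1)
    exact Measurable.ite hu (measurable_inl.comp he) measurable_const

variable {Θ : Type*} (m : ChangeModel E Θ)

theorem ChangeModel.measurable_usedLLR (used : ℕ → Set (ℕ → E)) (θ : Θ) {n k : ℕ} (h₁ : 1 ≤ k)
    (h₂ : k ≤ n) : Measurable[info used n] (m.usedLLR used θ k) := by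
  have e : m.usedLLR used θ k = Sum.elim (m.llr θ) (fun _ : Unit => 0) ∘ obs used k := by
    ext ω
    by_cases h : ω ∈ used k <;> simp [usedLLR, obs, h]
  rw [e]
  exact (Measurable.sumElim (m.measurable_llr θ) measurable_const).comp
    (measurable_info_obs used h₁ h₂)

theorem measurable_truncBelow (h : ℝ≥0∞) : Measurable (truncBelow h) := by
  unfold truncBelow
  split_ifs <;> fun_prop

theorem ChangeModel.le_glr_iff [Finite Θ] [Nonempty Θ] {used : ℕ → Set (ℕ → E)} {n : ℕ}
    (hn : 1 ≤ n) {A : ℝ} {ω : ℕ → E} :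
    A ≤ m.glr used n ω
      ↔ ∃ k, 1 ≤ k ∧ k ≤ n ∧ ∃ θ, A ≤ ∑ i ∈ Finset.Icc k n, m.usedLLR used θ i ω := by
  have : Nonempty (Set.Icc 1 n) := ⟨⟨1, le_rfl, hn⟩⟩
  constructor
  · intro h
    obtain ⟨k, hk⟩ := exists_eq_ciSup_of_finite (f := fun k : Set.Icc 1 n =>
      ⨆ θ : Θ, ∑ i ∈ Finset.Icc (k : ℕ) n, m.usedLLR used θ i ω)
    obtain ⟨θ, hθ⟩ := exists_eq_ciSup_of_finite (f := fun θ : Θ =>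
      ∑ i ∈ Finset.Icc (k : ℕ) n, m.usedLLR used θ i ω)
    refine ⟨k, k.2.1, k.2.2, θ, ?_⟩
    rw [hθ, hk]
    exact h
  · rintro ⟨k, h1, h2, θ, h3⟩
    refine h3.trans ?_
    refine (le_ciSup (f := fun θ : Θ => ∑ i ∈ Finset.Icc k n, m.usedLLR used θ i ω)
      (Set.finite_range _).bddAbove θ).trans ?_
    exact le_ciSup (f := fun k : Set.Icc 1 n =>
      ⨆ θ : Θ, ∑ i ∈ Finset.Icc (k : ℕ) n, m.usedLLR used θ i ω)
      (Set.finite_range _).bddAbove ⟨k, h1, h2⟩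

theorem ChangeModel.W_succ (θ : Θ) (μ : ℝ) (h : ℝ≥0∞) (n : ℕ) (ω : ℕ → E) :
    m.W θ μ h (n + 1) ω = if 0 ≤ m.W θ μ h n ω
      then truncBelow h (m.W θ μ h n ω + m.llr θ (ω (n + 1))) else min 0 (m.W θ μ h n ω + μ) :=
  rfl

theorem ChangeModel.mem_deUsed_succ {θ : Θ} {μ : ℝ} {h : ℝ≥0∞} {n : ℕ} {ω : ℕ → E} :
    ω ∈ m.deUsed θ μ h (n + 1) ↔ 0 ≤ m.W θ μ h n ω :=
  Iff.rfl

theorem ChangeModel.measurable_info_W (θ : Θ) (μ : ℝ) (h : ℝ≥0∞) (n : ℕ) :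
    Measurable[info (m.deUsed θ μ h) n] (m.W θ μ h n) := by
  induction n with
  | zero => exact @measurable_const _ _ _ (info (m.deUsed θ μ h) 0) 0
  | succ n ih =>
    have ih' := ih.mono (info_mono (m.deUsed θ μ h) (Nat.le_succ n)) le_rfl
    have hu := m.measurable_usedLLR (m.deUsed θ μ h) θ (Nat.le_add_left 1 n) le_rfl
    have e : m.W θ μ h (n + 1) = fun ω => if 0 ≤ m.W θ μ h n ω
        then truncBelow h (m.W θ μ h n ω + m.usedLLR (m.deUsed θ μ h) θ (n + 1) ω)
        else min 0 (m.W θ μ h n ω + μ) := by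
      ext ω
      rw [m.W_succ]
      by_cases hω : 0 ≤ m.W θ μ h n ω
      · rw [if_pos hω, if_pos hω, usedLLR, if_pos (m.mem_deUsed_succ.2 hω)]
      · rw [if_neg hω, if_neg hω]
    rw [e]
    let _ := info (m.deUsed θ μ h) (n + 1)
    exact Measurable.ite (measurableSet_le measurable_const ih')
      ((measurable_truncBelow h).comp (ih'.add hu)) (measurable_const.min (ih'.add_const μ))

theorem ChangeModel.measurableSet_info_deUsed (θ : Θ) (μ : ℝ) (h : ℝ≥0∞) (n : ℕ) :
    MeasurableSet[info (m.deUsed θ μ h) n] (m.deUsed θ μ h (n + 1)) :=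
  m.measurable_info_W θ μ h n measurableSet_Ici

theorem ChangeModel.measurable_W (θ : Θ) (μ : ℝ) (h : ℝ≥0∞) (n : ℕ) :
    Measurable[past n] (m.W θ μ h n) :=
  (m.measurable_info_W θ μ h n).mono (info_le_past (m.measurableSet_info_deUsed θ μ h) n) le_rfl

theorem ChangeModel.measurable_past_usedLLR (θ : Θ) (μ : ℝ) (h : ℝ≥0∞) (θ' : Θ) {n k : ℕ}
    (h₁ : 1 ≤ k) (h₂ : k ≤ n) : Measurable[past n] (m.usedLLR (m.deUsed θ μ h) θ' k) :=
  (m.measurable_usedLLR _ θ' h₁ h₂).mono (info_le_past (m.measurableSet_info_deUsed θ μ h) n) le_rfl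

theorem ChangeModel.admissible_GDECuSum [Finite Θ] (θ : Θ) (μ : ℝ) (h : ℝ≥0∞) (A : ℝ) :
    (m.GDECuSum θ μ h A).Admissible := by
  have : Nonempty Θ := ⟨θ⟩
  have : Countable Θ := Finite.to_countable
  refine ⟨m.measurableSet_info_deUsed θ μ h, fun n => ?_⟩
  have e : {ω | (m.GDECuSum θ μ h A).τ ω ≤ n} = ⋃ (j : ℕ) (_ : 1 ≤ j ∧ j ≤ n) (k : ℕ)
      (_ : 1 ≤ k ∧ k ≤ j) (θ' : Θ),
      {ω | A ≤ ∑ i ∈ Finset.Icc k j, m.usedLLR (m.deUsed θ μ h) θ' i ω} := by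
    ext ω
    simp only [GDECuSum, Set.mem_ofPred_eq, firstPassage_le_iff, Set.mem_iUnion, exists_prop]
    refine exists_congr fun j => ?_
    rw [and_assoc]
    refine and_congr_right fun hj => and_congr_right fun _ => ?_
    rw [m.le_glr_iff hj]
    simp only [and_assoc]
  rw [e]
  let _ := info (m.deUsed θ μ h) n
  refine .iUnion fun j => .iUnion fun hj => .iUnion fun k => .iUnion fun hk => .iUnion fun θ' => ?_
  refine measurableSet_le measurable_const (Finset.measurable_sum _ fun i hi => ?_)
  rw [Finset.mem_Icc] at hi
  exact m.measurable_usedLLR _ θ' (by omega) (by omega)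

/-- The DECuSum control with truncation at `-0` uses every observation. -/
theorem ChangeModel.deUsed_zero (θ : Θ) (μ : ℝ) : m.deUsed θ μ 0 = fun _ => Set.univ := by
  have hW : ∀ n ω, 0 ≤ m.W θ μ 0 n ω := by
    intro n ω
    induction n with
    | zero => exact le_rfl
    | succ n ih => rw [m.W_succ, if_pos ih, truncBelow, if_neg (by simp)]; simp
  funext n
  exact Set.eq_univ_of_forall fun ω => hW _ ω

theorem ChangeModel.GCuSum_eq_GDECuSum (θ : Θ) (μ A : ℝ) :
    m.GCuSum A = m.GDECuSum θ μ 0 A := by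
  rw [GCuSum, GDECuSum, m.deUsed_zero]

theorem Policy.Admissible.info_le {Ψ : Policy E} (hΨ : Ψ.Admissible) (n : ℕ) :
    info Ψ.used n ≤ past n :=
  info_le_past hΨ.measurableSet_used n

theorem Policy.Admissible.measurableSet_lt {Ψ : Policy E} (hΨ : Ψ.Admissible) (n : ℕ) :
    MeasurableSet[info Ψ.used n] {ω | (n : ℕ∞) < Ψ.τ ω} := by
  have h := (hΨ.measurableSet_stop n).compl
  have e : {ω | Ψ.τ ω ≤ n}ᶜ = {ω | (n : ℕ∞) < Ψ.τ ω} := by ext; simp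
  rwa [e] at h

theorem tsum_indicator_lt_sub (t : ℕ∞) (γ : ℕ) :
    ∑' n : ℕ, (if ((γ + n : ℕ) : ℕ∞) < t then (1 : ℝ≥0∞) else 0) = (t : ℝ≥0∞) - γ := by
  induction t using ENat.recTopCoe with
  | top => simp
  | coe t =>
    rw [tsum_eq_sum (s := Finset.range (t - γ)) (fun n hn => by
      have : ¬ n < t - γ := by simpa using hn
      rw [if_neg]
      simp only [Nat.cast_lt]; omega)]
    rw [Finset.sum_congr rfl (g := fun _ => 1) (fun n hn => by
      have : n < t - γ := by simpa using hn
      rw [if_pos]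
      simp only [Nat.cast_lt]; omega)]
    simp

theorem setLIntegral_tau_sub {Ψ : Policy E} (hΨ : Ψ.Admissible) (P : Measure (ℕ → E)) (γ : ℕ)
    (B : Set (ℕ → E)) :
    ∫⁻ ω in B, ((Ψ.τ ω : ℝ≥0∞) - (γ : ℝ≥0∞)) ∂P
      = ∑' n : ℕ, P ({ω | ((γ + n : ℕ) : ℕ∞) < Ψ.τ ω} ∩ B) := by
  have hm : ∀ n : ℕ, MeasurableSet {ω | (n : ℕ∞) < Ψ.τ ω} := fun n =>
    past_le n _ (hΨ.info_le n _ (hΨ.measurableSet_lt n))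
  simp_rw [← tsum_indicator_lt_sub]
  rw [lintegral_tsum fun n =>
    (Measurable.ite (hm (γ + n)) measurable_const measurable_const).aemeasurable]
  refine tsum_congr fun n => ?_
  rw [← Measure.restrict_apply (hm _), ← lintegral_indicator_one (hm _)]
  simp only [Set.indicator_apply, Set.mem_ofPred_eq, Pi.one_apply]

/-- The expectation of a stopping time as a sum of tail probabilities. -/
theorem lintegral_tau {Ψ : Policy E} (hΨ : Ψ.Admissible) (P : Measure (ℕ → E)) :
    ∫⁻ ω, (Ψ.τ ω : ℝ≥0∞) ∂P = ∑' n : ℕ, P {ω | (n : ℕ∞) < Ψ.τ ω} := by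
  simpa using setLIntegral_tau_sub hΨ P 0 Set.univ

end Information

/-! ### The CuSum statistics and the false alarm rate -/

namespace ChangeModel

variable {E : Type*} [MeasurableSpace E] {Θ : Type*} (m : ChangeModel E Θ)

/-- The vector of CuSum statistics, one for each parameter, of the observations that are used,
reflected at `0`. For positive thresholds it carries the same information as `glr`. -/
noncomputable def cusum (used : ℕ → Set (ℕ → E)) : ℕ → (ℕ → E) → Θ → ℝ
  | 0, _, _ => 0
  | n + 1, ω, θ => max (cusum used n ω θ + m.usedLLR used θ (n + 1) ω) 0

theorem cusum_nonneg (used : ℕ → Set (ℕ → E)) (n : ℕ) (ω : ℕ → E) (θ : Θ) :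
    0 ≤ m.cusum used n ω θ := by
  cases n with
  | zero => exact le_rfl
  | succ n => exact le_max_right _ _

theorem le_cusum_iff (used : ℕ → Set (ℕ → E)) (n : ℕ) (ω : ℕ → E) (θ : Θ) {A : ℝ} (hA : 0 < A) :
    A ≤ m.cusum used n ω θ
      ↔ ∃ k, 1 ≤ k ∧ k ≤ n ∧ A ≤ ∑ i ∈ Finset.Icc k n, m.usedLLR used θ i ω := by
  induction n generalizing A with
  | zero =>
    constructor
    · intro h
      exact absurd h (not_le.2 hA)
    · rintro ⟨k, h1, h2, -⟩
      omega
  | succ n ih =>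
    have h0 := m.cusum_nonneg used n ω θ
    have e : A ≤ m.cusum used (n + 1) ω θ
        ↔ A - m.usedLLR used θ (n + 1) ω ≤ m.cusum used n ω θ := by
      change A ≤ max _ _ ↔ _
      rw [le_max_iff, or_iff_left (not_le.2 hA), sub_le_iff_le_add]
    rw [e]
    constructor
    · intro h
      rcases le_or_gt (A - m.usedLLR used θ (n + 1) ω) 0 with h1 | h1
      · exact ⟨n + 1, by omega, le_rfl, by simpa using h1⟩
      · obtain ⟨k, hk1, hk2, hk3⟩ := (ih h1).1 h
        refine ⟨k, hk1, by omega, ?_⟩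
        rw [Finset.sum_Icc_succ_top (by omega)]
        linarith
    · rintro ⟨k, hk1, hk2, hk3⟩
      rcases le_or_gt (A - m.usedLLR used θ (n + 1) ω) 0 with h1 | h1
      · exact h1.trans h0
      · have hk : k ≠ n + 1 := by
          rintro rfl
          rw [Finset.Icc_self, Finset.sum_singleton] at hk3
          linarith
        rw [Finset.sum_Icc_succ_top (by omega)] at hk3
        exact (ih h1).2 ⟨k, hk1, by omega, by linarith⟩

/-- The paths along which no CuSum statistic has reached `A` by time `n`. -/
def alive (used : ℕ → Set (ℕ → E)) (A : ℝ) (n : ℕ) : Set (ℕ → E) :=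
  {ω | ∀ j ≤ n, ∀ θ, m.cusum used j ω θ < A}

theorem lt_firstPassage_glr_iff [Finite Θ] [Nonempty Θ] {used : ℕ → Set (ℕ → E)} {A : ℝ}
    (hA : 0 < A) {n : ℕ} {ω : ℕ → E} :
    (n : ℕ∞) < firstPassage (m.glr used) A ω ↔ ω ∈ m.alive used A n := by
  rw [lt_firstPassage_iff]
  have key : ∀ j, 1 ≤ j → (m.glr used j ω < A ↔ ∀ θ, m.cusum used j ω θ < A) := by
    intro j hj
    rw [← not_le, m.le_glr_iff hj]
    constructor
    · intro h θ
      by_contra! hc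
      obtain ⟨k, h1, h2, h3⟩ := (m.le_cusum_iff used j ω θ hA).1 hc
      exact h ⟨k, h1, h2, θ, h3⟩
    · rintro h ⟨k, h1, h2, θ, h3⟩
      exact absurd ((m.le_cusum_iff used j ω θ hA).2 ⟨k, h1, h2, h3⟩) (not_le.2 (h θ))
  constructor
  · intro h j hj θ
    rcases Nat.eq_zero_or_pos j with rfl | h0
    · exact hA
    · exact (key j h0).1 (h j h0 hj) θ
  · intro h j h1 h2
    exact (key j h1).2 (h j h2)

theorem alive_zero (used : ℕ → Set (ℕ → E)) {A : ℝ} (hA : 0 < A) :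
    m.alive used A 0 = Set.univ :=
  Set.eq_univ_of_forall fun ω j hj θ => by rw [Nat.le_zero.1 hj]; exact hA

theorem mem_alive_succ {used : ℕ → Set (ℕ → E)} {A : ℝ} {n : ℕ} {ω : ℕ → E} :
    ω ∈ m.alive used A (n + 1)
      ↔ ω ∈ m.alive used A n ∧ ∀ θ, m.cusum used (n + 1) ω θ < A := by
  constructor
  · exact fun h => ⟨fun j hj => h j (by omega), h _ le_rfl⟩
  · rintro ⟨h1, h2⟩ j hj
    rcases Nat.lt_or_ge n j with h | h
    · obtain rfl : j = n + 1 := by omega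
      exact h2
    · exact h1 j h

section Measurability

variable {used : ℕ → Set (ℕ → E)} (hu : ∀ n, MeasurableSet[info used n] (used (n + 1)))
include hu

theorem measurable_cusum (n : ℕ) : Measurable[past n] (m.cusum used n) := by
  induction n with
  | zero => exact @measurable_const _ _ _ (past 0) (fun _ => (0 : ℝ))
  | succ n ih =>
    have ih' := ih.mono (past_mono (Nat.le_succ n)) le_rfl
    have hl := fun θ => (m.measurable_usedLLR used θ (Nat.le_add_left 1 n) le_rfl).mono
      (info_le_past hu (n + 1)) le_rfl
    let _ := past (E := E) (n + 1)
    refine measurable_pi_lambda _ fun θ => ?_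
    exact (((measurable_pi_apply θ).comp ih').add (hl θ)).max measurable_const

theorem measurableSet_alive [Countable Θ] (A : ℝ) (n : ℕ) :
    MeasurableSet[past n] (m.alive used A n) := by
  have e : m.alive used A n = ⋂ (j : ℕ) (_ : j ≤ n) (θ : Θ), {ω | m.cusum used j ω θ < A} := by
    ext ω; simp [alive]
  have h := fun j (hj : j ≤ n) => (m.measurable_cusum hu j).mono (past_mono hj) le_rfl
  let _ := past (E := E) n
  rw [e]
  exact .iInter fun j => .iInter fun hj => .iInter fun θ =>
    measurableSet_lt ((measurable_pi_apply θ).comp (h j hj)) measurable_const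

end Measurability

/-- The Shiryaev-Roberts statistics `∑_{k = 1}^n ∏_{i = k}^n f θ (X i) / f₀ (X i)`. -/
noncomputable def shiryaevRoberts : ℕ → (ℕ → E) → Θ → ℝ≥0∞
  | 0, _, _ => 0
  | n + 1, ω, θ =>
    (1 + shiryaevRoberts n ω θ) * ENNReal.ofReal (Real.exp (m.llr θ (ω (n + 1))))

theorem measurable_shiryaevRoberts (n : ℕ) : Measurable[past n] (m.shiryaevRoberts n) := by
  induction n with
  | zero => exact @measurable_const _ _ _ (past 0) (fun _ => (0 : ℝ≥0∞))
  | succ n ih =>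
    have ih' := ih.mono (past_mono (Nat.le_succ n)) le_rfl
    have hl := measurable_past_eval (E := E) (Nat.le_add_left 1 n) le_rfl
    let _ := past (E := E) (n + 1)
    refine measurable_pi_lambda _ fun θ => ?_
    have h1 := ((measurable_pi_apply θ).comp ih').const_add 1
    exact h1.mul (((m.measurable_llr θ).comp hl).exp.ennreal_ofReal)

/-- A positive CuSum statistic is a sum `∑_{i = k}^n L_θ (X i)`, whose exponential is one of the
terms of the Shiryaev-Roberts statistic. -/
theorem exp_cusum_le (n : ℕ) (ω : ℕ → E) (θ : Θ) :
    ENNReal.ofReal (Real.exp (m.cusum (fun _ => Set.univ) n ω θ))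
      ≤ 1 + m.shiryaevRoberts n ω θ ∧
    (0 < m.cusum (fun _ => Set.univ) n ω θ →
      ENNReal.ofReal (Real.exp (m.cusum (fun _ => Set.univ) n ω θ))
        ≤ m.shiryaevRoberts n ω θ) := by
  induction n with
  | zero => simp [cusum]
  | succ n ih =>
    have h2 : 0 < m.cusum (fun _ => Set.univ) (n + 1) ω θ →
        ENNReal.ofReal (Real.exp (m.cusum (fun _ => Set.univ) (n + 1) ω θ))
        ≤ m.shiryaevRoberts (n + 1) ω θ := by
      intro h
      have e : m.cusum (fun _ => Set.univ) (n + 1) ω θ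
          = m.cusum (fun _ => Set.univ) n ω θ + m.llr θ (ω (n + 1)) := by
        simp only [cusum, usedLLR, Set.mem_univ, if_true] at h ⊢
        rcases le_total (m.cusum (fun _ => Set.univ) n ω θ + m.llr θ (ω (n + 1))) 0 with h1 | h1
        · rw [max_eq_right h1] at h
          exact absurd h (lt_irrefl _)
        · rw [max_eq_left h1]
      rw [e, Real.exp_add, ENNReal.ofReal_mul (Real.exp_pos _).le, shiryaevRoberts]
      gcongr
      exact ih.1
    refine ⟨?_, h2⟩
    rcases (m.cusum_nonneg (fun _ => Set.univ) (n + 1) ω θ).eq_or_lt with h | h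
    · rw [← h]; simp
    · exact (h2 h).trans le_add_self

theorem measurableSet_info_univ (n : ℕ) :
    MeasurableSet[info (E := E) (fun _ => Set.univ) n] Set.univ :=
  @MeasurableSet.univ _ (info (fun _ => Set.univ) n)

theorem admissible_GCuSum [Finite Θ] [Nonempty Θ] (A : ℝ) : (m.GCuSum A).Admissible := by
  rw [m.GCuSum_eq_GDECuSum (Classical.arbitrary Θ) 1 A]
  exact m.admissible_GDECuSum _ _ _ _

/-- The false alarm rate of GCuSum: `∑_θ R_n θ - |Θ| n` is a martingale, where `R` is the
Shiryaev-Roberts statistic, and `∑_θ R_n θ ≥ e ^ A` at the time of an alarm. -/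
theorem exp_le_card_mul_lintegral_tau [Fintype Θ] [Nonempty Θ] (hD : ∀ θ, m.D θ < ∞)
    (hD' : ∀ θ, m.D' θ < ∞) {A : ℝ} (hA : 0 < A) :
    ENNReal.ofReal (Real.exp A)
      ≤ Fintype.card Θ * ∫⁻ ω, ((m.GCuSum A).τ ω : ℝ≥0∞) ∂m.pathInf := by
  set al := m.alive (fun _ => Set.univ) A with hal
  have halm : ∀ n, MeasurableSet[past n] (al n) :=
    fun n => m.measurableSet_alive measurableSet_info_univ A n
  have halm' : ∀ n, MeasurableSet (al n) := fun n => past_le n _ (halm n)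
  have hsub : ∀ n, al (n + 1) ⊆ al n := fun n ω h => (m.mem_alive_succ.1 h).1
  set R : ℕ → (ℕ → E) → ℝ≥0∞ := fun n ω => ∑ θ, m.shiryaevRoberts n ω θ with hR
  set a : ℕ → ℝ≥0∞ := fun n => ∫⁻ ω in al n, R n ω ∂m.pathInf with ha
  set d : ℕ → ℝ≥0∞ := fun n => m.pathInf (al n \ al (n + 1)) with hd
  set s : ℕ → ℝ≥0∞ := fun n => m.pathInf (al n) with hs
  have hτ : ∫⁻ ω, ((m.GCuSum A).τ ω : ℝ≥0∞) ∂m.pathInf = ∑' n, s n := by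
    rw [lintegral_tau (m.admissible_GCuSum A)]
    refine tsum_congr fun n => ?_
    congr 1
    ext ω
    exact m.lt_firstPassage_glr_iff hA
  have h1 : ∀ n, ∫⁻ ω in al n, R (n + 1) ω ∂m.pathInf = Fintype.card Θ * s n + a n := by
    intro n
    have hZ : Measurable[past n] fun ω : ℕ → E =>
        ((al n).indicator (1 : (ℕ → E) → ℝ≥0∞) ω, m.shiryaevRoberts n ω) := by
      have h2 := m.measurable_shiryaevRoberts n
      have h3 := halm n
      let _ := past (E := E) n
      exact (measurable_one.indicator h3).prodMk h2
    have hg : Measurable (Function.uncurry fun (z : ℝ≥0∞ × (Θ → ℝ≥0∞)) (x : E) =>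
        z.1 * ∑ θ, (1 + z.2 θ) * ENNReal.ofReal (Real.exp (m.llr θ x))) := by
      have := m.measurable_llr
      unfold Function.uncurry
      fun_prop
    have h4 := lintegral_step (fun _ => m.P₀) hZ hg
    have h5 : ∀ z : ℝ≥0∞ × (Θ → ℝ≥0∞), ∫⁻ x, z.1 * ∑ θ, (1 + z.2 θ) *
        ENNReal.ofReal (Real.exp (m.llr θ x)) ∂m.P₀ = z.1 * ∑ θ, (1 + z.2 θ) := by
      intro z
      have := m.measurable_llr
      rw [lintegral_const_mul _ (by fun_prop), lintegral_finsetSum _ (by fun_prop)]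
      congr 1
      refine Finset.sum_congr rfl fun θ _ => ?_
      rw [lintegral_const_mul _ (by fun_prop), m.lintegral_exp_llr (hD θ) (hD' θ), mul_one]
    have hR' : Measurable (R n) :=
      Finset.measurable_sum _ fun θ _ => (measurable_pi_apply θ).comp
        ((m.measurable_shiryaevRoberts n).mono (past_le n) le_rfl)
    calc ∫⁻ ω in al n, R (n + 1) ω ∂m.pathInf
        = ∫⁻ ω, (al n).indicator 1 ω * R (n + 1) ω ∂m.pathInf := by
          rw [← lintegral_indicator (halm' n)]
          congr 1; ext ω
          by_cases h : ω ∈ al n <;> simp [h]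
      _ = ∫⁻ ω, (al n).indicator 1 ω * ∑ θ, (1 + m.shiryaevRoberts n ω θ) ∂m.pathInf :=
          h4.trans (lintegral_congr fun ω => h5 (_, m.shiryaevRoberts n ω))
      _ = ∫⁻ ω in al n, (Fintype.card Θ + R n ω) ∂m.pathInf := by
          rw [← lintegral_indicator (halm' n)]
          congr 1; ext ω
          by_cases h : ω ∈ al n <;> simp [h, hR, Finset.sum_add_distrib]
      _ = _ := by
          rw [lintegral_add_right _ hR', setLIntegral_const]
  have h2 : ∀ n, ENNReal.ofReal (Real.exp A) * d n + a (n + 1) ≤ Fintype.card Θ * s n + a n := by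
    intro n
    rw [← h1 n, ← lintegral_inter_add_sdiff (R (n + 1)) (al n) (halm' (n + 1)),
      Set.inter_eq_right.2 (hsub n), add_comm]
    gcongr
    rw [← setLIntegral_const]
    refine setLIntegral_mono' ((halm' n).diff (halm' (n + 1))) fun ω hω => ?_
    have h3 : ∃ θ, A ≤ m.cusum (fun _ => Set.univ) (n + 1) ω θ := by
      by_contra! hc
      exact hω.2 (m.mem_alive_succ.2 ⟨hω.1, hc⟩)
    obtain ⟨θ, hθ⟩ := h3
    calc ENNReal.ofReal (Real.exp A)
        ≤ ENNReal.ofReal (Real.exp (m.cusum (fun _ => Set.univ) (n + 1) ω θ)) := by gcongr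
      _ ≤ m.shiryaevRoberts (n + 1) ω θ := (m.exp_cusum_le (n + 1) ω θ).2 (hA.trans_le hθ)
      _ ≤ R (n + 1) ω := Finset.single_le_sum (f := fun θ => m.shiryaevRoberts (n + 1) ω θ)
          (fun _ _ => zero_le) (Finset.mem_univ θ)
  have h3 : ∀ N, ENNReal.ofReal (Real.exp A) * ∑ n ∈ Finset.range N, d n + a N
      ≤ Fintype.card Θ * ∑ n ∈ Finset.range N, s n := by
    intro N
    induction N with
    | zero => simp [ha, hR, shiryaevRoberts]
    | succ N ih =>
      rw [Finset.sum_range_succ, Finset.sum_range_succ, mul_add, mul_add, add_assoc]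
      calc _ ≤ ENNReal.ofReal (Real.exp A) * ∑ n ∈ Finset.range N, d n
            + (Fintype.card Θ * s N + a N) := add_le_add le_rfl (h2 N)
        _ = (ENNReal.ofReal (Real.exp A) * ∑ n ∈ Finset.range N, d n + a N)
            + Fintype.card Θ * s N := by ring
        _ ≤ _ := by gcongr
  have h4 : ∀ N, ∑ n ∈ Finset.range N, d n + s N = 1 := by
    intro N
    induction N with
    | zero => simp [hs, hal, m.alive_zero _ hA]
    | succ N ih =>
      rw [Finset.sum_range_succ, add_assoc, ← ih]
      congr 1
      simp only [hd, hs]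
      rw [add_comm, ← measure_inter_add_sdiff (al N) (halm' (N + 1)),
        Set.inter_eq_right.2 (hsub N)]
  rw [hτ]
  by_cases hfin : ∑' n, s n = ∞
  · rw [hfin, ENNReal.mul_top (by simp)]
    exact le_top
  have h5 : Tendsto s atTop (𝓝 0) := ENNReal.tendsto_atTop_zero_of_tsum_ne_top hfin
  have h6 : ∀ N, ENNReal.ofReal (Real.exp A)
      ≤ Fintype.card Θ * ∑' n, s n + ENNReal.ofReal (Real.exp A) * s N := by
    intro N
    calc ENNReal.ofReal (Real.exp A)
        = ENNReal.ofReal (Real.exp A) * ∑ n ∈ Finset.range N, d n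
          + ENNReal.ofReal (Real.exp A) * s N := by rw [← mul_add, h4, mul_one]
      _ ≤ _ := add_le_add ((le_self_add.trans (h3 N)).trans
          (by gcongr; exact ENNReal.sum_le_tsum _)) le_rfl
  have h7 : Tendsto (fun N => (Fintype.card Θ : ℝ≥0∞) * ∑' n, s n
      + ENNReal.ofReal (Real.exp A) * s N) atTop
      (𝓝 ((Fintype.card Θ : ℝ≥0∞) * ∑' n, s n + ENNReal.ofReal (Real.exp A) * 0)) :=
    tendsto_const_nhds.add (ENNReal.Tendsto.const_mul h5 (Or.inr ENNReal.ofReal_ne_top))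
  rw [mul_zero, add_zero] at h7
  exact ge_of_tendsto' h7 h6

theorem FAR_GCuSum_le [Fintype Θ] [Nonempty Θ] (hD : ∀ θ, m.D θ < ∞) (hD' : ∀ θ, m.D' θ < ∞)
    {α : ℝ} (h0 : 0 < α) (h1 : α < Fintype.card Θ) :
    m.FAR (m.GCuSum (Real.log (Fintype.card Θ / α))) ≤ ENNReal.ofReal α := by
  have hc : (0 : ℝ) < Fintype.card Θ := h0.trans h1
  have hA : 0 < Real.log (Fintype.card Θ / α) := Real.log_pos ((one_lt_div h0).2 h1)
  have h := m.exp_le_card_mul_lintegral_tau hD hD' hA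
  rw [Real.exp_log (div_pos hc h0), div_eq_mul_inv, ENNReal.ofReal_mul hc.le,
    ENNReal.ofReal_natCast, ENNReal.ofReal_inv_of_pos h0] at h
  rw [FAR, ENNReal.inv_le_iff_inv_le]
  exact (ENNReal.mul_le_mul_iff_right (by simp) (by simp)).1 h

/-- The probability that GCuSum with threshold `A`, started from the CuSum statistics `p`, raises
no alarm during `j` observations from the pre-change law. -/
noncomputable def survival (A : ℝ) : ℕ → (Θ → ℝ) → ℝ≥0∞
  | 0, _ => 1
  | j + 1, p => ∫⁻ x, {p' : Θ → ℝ | ∀ θ, p' θ < A}.indicator (survival A j)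
      (fun θ => max (p θ + m.llr θ x) 0) ∂m.P₀

theorem measurable_survival [Countable Θ] (A : ℝ) (j : ℕ) : Measurable (m.survival A j) := by
  induction j with
  | zero => exact measurable_const
  | succ j ih =>
    refine Measurable.lintegral_prod_right' (f := fun z : (Θ → ℝ) × E =>
      {p' : Θ → ℝ | ∀ θ, p' θ < A}.indicator (m.survival A j)
        (fun θ => max (z.1 θ + m.llr θ z.2) 0)) ?_
    have hs : MeasurableSet {p' : Θ → ℝ | ∀ θ, p' θ < A} := by
      rw [show {p' : Θ → ℝ | ∀ θ, p' θ < A} = ⋂ θ, {p' | p' θ < A} by ext; simp]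
      exact .iInter fun θ => measurableSet_lt (measurable_pi_apply θ) measurable_const
    have := m.measurable_llr
    exact (ih.indicator hs).comp (by fun_prop)

theorem survival_succ_le (A : ℝ) (j : ℕ) (p : Θ → ℝ) :
    m.survival A (j + 1) p ≤ m.survival A j p := by
  induction j generalizing p with
  | zero =>
    calc m.survival A 1 p ≤ ∫⁻ _, 1 ∂m.P₀ :=
          lintegral_mono fun x => Set.indicator_le_self _ _ _
      _ = 1 := by simp
  | succ j ih =>
    refine lintegral_mono fun x => ?_
    exact Set.indicator_le_indicator (ih _)

/-- One step of the comparison between GDECuSum and GCuSum: an observation that is skipped changes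
neither the CuSum statistics nor the number of observations that GCuSum has left. -/
theorem lintegral_alive_survival [Countable Θ] (s : Θ) (μ : ℝ) (h : ℝ≥0∞) (A : ℝ) (n j : ℕ) :
    ∫⁻ ω in m.alive (m.deUsed s μ h) A (n + 1),
        m.survival A j (m.cusum (m.deUsed s μ h) (n + 1) ω) ∂m.pathInf
      = ∫⁻ ω in m.alive (m.deUsed s μ h) A n, (if 0 ≤ m.W s μ h n ω
          then m.survival A (j + 1) (m.cusum (m.deUsed s μ h) n ω)
          else m.survival A j (m.cusum (m.deUsed s μ h) n ω)) ∂m.pathInf := by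
  have hu := m.measurableSet_info_deUsed s μ h
  have halm : ∀ n, MeasurableSet[past n] (m.alive (m.deUsed s μ h) A n) :=
    fun n => m.measurableSet_alive hu A n
  have halm' : ∀ n, MeasurableSet (m.alive (m.deUsed s μ h) A n) :=
    fun n => past_le n _ (halm n)
  have hs : MeasurableSet {p' : Θ → ℝ | ∀ θ, p' θ < A} := by
    rw [show {p' : Θ → ℝ | ∀ θ, p' θ < A} = ⋂ θ, {p' | p' θ < A} by ext; simp]
    exact .iInter fun θ => measurableSet_lt (measurable_pi_apply θ) measurable_const
  rw [← lintegral_indicator (halm' _), ← lintegral_indicator (halm' _)]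
  have hZ : Measurable[past n] fun ω : ℕ → E =>
      ((m.alive (m.deUsed s μ h) A n).indicator (1 : (ℕ → E) → ℝ≥0∞) ω,
        m.cusum (m.deUsed s μ h) n ω, m.W s μ h n ω) := by
    have h2 := m.measurable_cusum hu n
    have h3 := halm n
    have h4 := m.measurable_W s μ h n
    let _ := past (E := E) n
    exact (measurable_one.indicator h3).prodMk (h2.prodMk h4)
  have hsv := m.measurable_survival A j
  have hl := m.measurable_llr
  have hg : Measurable (Function.uncurry fun (z : ℝ≥0∞ × (Θ → ℝ) × ℝ) (x : E) =>
      z.1 * if 0 ≤ z.2.2 then {p' : Θ → ℝ | ∀ θ, p' θ < A}.indicator (m.survival A j)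
        (fun θ => max (z.2.1 θ + m.llr θ x) 0) else m.survival A j z.2.1) := by
    unfold Function.uncurry
    refine Measurable.mul (by fun_prop) (Measurable.ite ?_ ?_ (by fun_prop))
    · exact measurableSet_le measurable_const (by fun_prop)
    · exact (hsv.indicator hs).comp (by fun_prop)
  refine (lintegral_congr fun ω => ?_).trans ((lintegral_step (fun _ => m.P₀) hZ hg).trans
    (lintegral_congr fun ω => ?_))
  · by_cases hω : ω ∈ m.alive (m.deUsed s μ h) A n
    · rw [Set.indicator_of_mem hω, Pi.one_apply, one_mul]
      by_cases hW : 0 ≤ m.W s μ h n ω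
      · have e : m.cusum (m.deUsed s μ h) (n + 1) ω = fun θ =>
            max (m.cusum (m.deUsed s μ h) n ω θ + m.llr θ (ω (n + 1))) 0 := by
          ext θ
          rw [cusum, usedLLR, if_pos (m.mem_deUsed_succ.2 hW)]
        rw [if_pos hW, ← e]
        by_cases hω' : ω ∈ m.alive (m.deUsed s μ h) A (n + 1)
        · rw [Set.indicator_of_mem hω', Set.indicator_of_mem]
          exact (m.mem_alive_succ.1 hω').2
        · rw [Set.indicator_of_notMem hω', Set.indicator_of_notMem]
          exact fun hc => hω' (m.mem_alive_succ.2 ⟨hω, hc⟩)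
      · have e : m.cusum (m.deUsed s μ h) (n + 1) ω = m.cusum (m.deUsed s μ h) n ω := by
          ext θ
          rw [cusum, usedLLR, if_neg (fun hc => hW (m.mem_deUsed_succ.1 hc)), add_zero,
            max_eq_left (m.cusum_nonneg _ _ _ _)]
        rw [if_neg hW, Set.indicator_of_mem, e]
        exact m.mem_alive_succ.2 ⟨hω, by rw [e]; exact hω n le_rfl⟩
    · rw [Set.indicator_of_notMem hω, Set.indicator_of_notMem, zero_mul]
      exact fun hc => hω (m.mem_alive_succ.1 hc).1
  · by_cases hω : ω ∈ m.alive (m.deUsed s μ h) A n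
    · rw [Set.indicator_of_mem hω, Set.indicator_of_mem hω]
      by_cases hW : 0 ≤ m.W s μ h n ω <;> simp [hW, survival]
    · simp [hω]

/-- GDECuSum is at least as likely as GCuSum to raise no alarm until time `N`, because it has used
at most `N` observations by then. -/
theorem survival_le_alive [Countable Θ] (s : Θ) (μ : ℝ) (h : ℝ≥0∞) {A : ℝ} (hA : 0 < A)
    (N : ℕ) :
    m.survival A N (fun _ => 0) ≤ m.pathInf (m.alive (m.deUsed s μ h) A N) := by
  have key : ∀ n j, ∫⁻ ω in m.alive (m.deUsed s μ h) A n,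
      m.survival A (j + 1) (m.cusum (m.deUsed s μ h) n ω) ∂m.pathInf
      ≤ ∫⁻ ω in m.alive (m.deUsed s μ h) A (n + 1),
        m.survival A j (m.cusum (m.deUsed s μ h) (n + 1) ω) ∂m.pathInf := by
    intro n j
    rw [m.lintegral_alive_survival]
    refine lintegral_mono fun ω => ?_
    dsimp only
    split_ifs
    · exact le_rfl
    · exact m.survival_succ_le A j _
  have h1 : ∀ n, n ≤ N → m.survival A N (fun _ => 0) ≤ ∫⁻ ω in m.alive (m.deUsed s μ h) A n,
      m.survival A (N - n) (m.cusum (m.deUsed s μ h) n ω) ∂m.pathInf := by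
    intro n
    induction n with
    | zero =>
      intro _
      rw [m.alive_zero _ hA, Measure.restrict_univ]
      simp only [cusum, Nat.sub_zero]
      rw [lintegral_const, measure_univ, mul_one]
    | succ n ih =>
      intro hn
      refine (ih (by omega)).trans ?_
      obtain ⟨j, hj⟩ : ∃ j, N - n = j + 1 := ⟨N - n - 1, by omega⟩
      rw [hj, show N - (n + 1) = j by omega]
      exact key n j
  simpa [survival] using h1 N le_rfl

theorem survival_eq_alive [Countable Θ] (s : Θ) {A : ℝ} (hA : 0 < A) (N : ℕ) :
    m.pathInf (m.alive (m.deUsed s 1 0) A N) = m.survival A N (fun _ => 0) := by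
  have key : ∀ n j, ∫⁻ ω in m.alive (m.deUsed s 1 0) A (n + 1),
        m.survival A j (m.cusum (m.deUsed s 1 0) (n + 1) ω) ∂m.pathInf
      = ∫⁻ ω in m.alive (m.deUsed s 1 0) A n,
      m.survival A (j + 1) (m.cusum (m.deUsed s 1 0) n ω) ∂m.pathInf := by
    intro n j
    rw [m.lintegral_alive_survival]
    refine lintegral_congr fun ω => if_pos ?_
    rw [← m.mem_deUsed_succ, m.deUsed_zero]
    trivial
  have h1 : ∀ n, n ≤ N → m.survival A N (fun _ => 0) = ∫⁻ ω in m.alive (m.deUsed s 1 0) A n,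
      m.survival A (N - n) (m.cusum (m.deUsed s 1 0) n ω) ∂m.pathInf := by
    intro n
    induction n with
    | zero =>
      intro _
      rw [m.alive_zero _ hA, Measure.restrict_univ]
      simp only [cusum, Nat.sub_zero]
      rw [lintegral_const, measure_univ, mul_one]
    | succ n ih =>
      intro hn
      rw [ih (by omega)]
      obtain ⟨j, hj⟩ : ∃ j, N - n = j + 1 := ⟨N - n - 1, by omega⟩
      rw [hj, show N - (n + 1) = j by omega, key]
  simpa [survival] using (h1 N le_rfl).symm

theorem FAR_GDECuSum_le_FAR_GCuSum [Finite Θ] (s : Θ) (μ : ℝ) (h : ℝ≥0∞) {A : ℝ} (hA : 0 < A) :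
    m.FAR (m.GDECuSum s μ h A) ≤ m.FAR (m.GCuSum A) := by
  have : Nonempty Θ := ⟨s⟩
  have : Countable Θ := Finite.to_countable
  have e : ∀ μ h (n : ℕ), {ω | (n : ℕ∞) < (m.GDECuSum s μ h A).τ ω}
      = m.alive (m.deUsed s μ h) A n := fun μ h n => by
    ext ω; exact m.lt_firstPassage_glr_iff hA
  rw [m.GCuSum_eq_GDECuSum s 1 A, FAR, FAR, ENNReal.inv_le_inv,
    lintegral_tau (m.admissible_GDECuSum _ _ _ _), lintegral_tau (m.admissible_GDECuSum _ _ _ _)]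
  refine ENNReal.tsum_le_tsum fun n => ?_
  rw [e, e, m.survival_eq_alive s hA]
  exact m.survival_le_alive s μ h hA n

end ChangeModel

/-! ### First passage of random walks with positive drift -/

section RandomWalk

variable {E : Type*} [MeasurableSpace E] (ν : Measure E) {L : E → ℝ}

theorem integrable_min_const [IsProbabilityMeasure ν] (hi : Integrable L ν) (c : ℝ) :
    Integrable (fun x => min (L x) c) ν :=
  hi.inf (integrable_const c)

theorem integral_min_const_le [IsProbabilityMeasure ν] (hi : Integrable L ν) (c : ℝ) :
    ∫ x, min (L x) c ∂ν ≤ c := by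
  calc ∫ x, min (L x) c ∂ν ≤ ∫ _, c ∂ν :=
        integral_mono (integrable_min_const ν hi c) (integrable_const c) fun x => min_le_right _ _
    _ = c := by simp

theorem tendsto_integral_min [IsProbabilityMeasure ν] (hi : Integrable L ν) :
    Tendsto (fun c => ∫ x, min (L x) c ∂ν) atTop (𝓝 (∫ x, L x ∂ν)) := by
  refine tendsto_integral_filter_of_dominated_convergence (fun x => ‖L x‖)
    (Eventually.of_forall fun c => (integrable_min_const ν hi c).aestronglyMeasurable) ?_ hi.norm ?_
  · filter_upwards [eventually_ge_atTop 0] with c hc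
    refine Eventually.of_forall fun x => ?_
    rw [Real.norm_eq_abs, Real.norm_eq_abs]
    rcases le_total (L x) c with h | h
    · rw [min_eq_left h]
    · rw [min_eq_right h, abs_of_nonneg hc]
      exact h.trans (le_abs_self _)
  · refine Eventually.of_forall fun x => tendsto_const_nhds.congr' ?_
    filter_upwards [eventually_ge_atTop (L x)] with c hc
    rw [min_eq_left hc]

/-- Wald's inequality in one step: before a random walk with increments `L` passes `A`, the
potential `A - a + c` decreases on average by at least `E[min L c]`, and truncation keeps the
overshoot below `c`. -/
theorem wald_step [IsProbabilityMeasure ν] (hi : Integrable L ν) {c : ℝ}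
    (hd : 0 ≤ ∫ x, min (L x) c ∂ν) {a A : ℝ} (ha : a ≤ A) :
    ENNReal.ofReal (∫ x, min (L x) c ∂ν)
      + ∫⁻ x, (if a + L x < A then ENNReal.ofReal (A - (a + L x) + c) else 0) ∂ν
      ≤ ENNReal.ofReal (A - a + c) := by
  have hi' : Integrable (fun x => A - a + c - min (L x) c) ν :=
    (integrable_const _).sub (integrable_min_const ν hi c)
  have h1 : ∫⁻ x, (if a + L x < A then ENNReal.ofReal (A - (a + L x) + c) else 0) ∂ν
      ≤ ENNReal.ofReal (A - a + c - ∫ x, min (L x) c ∂ν) := by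
    have e : A - a + c - ∫ x, min (L x) c ∂ν = ∫ x, (A - a + c - min (L x) c) ∂ν := by
      rw [integral_sub (integrable_const _) (integrable_min_const ν hi c)]
      simp
    rw [e, ofReal_integral_eq_lintegral_ofReal hi' (Eventually.of_forall fun x => ?_)]
    · refine lintegral_mono fun x => ?_
      dsimp only
      split_ifs
      · refine ENNReal.ofReal_le_ofReal ?_
        have := min_le_left (L x) c
        linarith
      · exact zero_le
    · have := min_le_right (L x) c
      simp only [Pi.zero_apply]
      linarith
  have h2 := integral_min_const_le ν hi c
  calc _ ≤ ENNReal.ofReal (∫ x, min (L x) c ∂ν)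
        + ENNReal.ofReal (A - a + c - ∫ x, min (L x) c ∂ν) := by gcongr
    _ = _ := by
      rw [← ENNReal.ofReal_add hd (by linarith)]
      congr 1; ring

variable (L) in
/-- The law of a random walk with increments `L`, started at `0`, at time `j`, restricted to the
event that it was negative at all times `1, …, j`. -/
noncomputable def negWalk : ℕ → Measure ℝ
  | 0 => Measure.dirac 0
  | j + 1 => (((negWalk j).prod ν).map fun z => z.1 + L z.2).restrict (Set.Iio 0)

instance isFiniteMeasure_negWalk [IsProbabilityMeasure ν] (j : ℕ) :
    IsFiniteMeasure (negWalk ν L j) := by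
  induction j with
  | zero => unfold negWalk; infer_instance
  | succ j ih => unfold negWalk; infer_instance

theorem negWalk_ae_nonpos (j : ℕ) : ∀ᵐ y ∂negWalk ν L j, y ≤ 0 := by
  cases j with
  | zero => rw [negWalk, ae_dirac_iff measurableSet_Iic]
  | succ j =>
    rw [negWalk]
    filter_upwards [ae_restrict_mem measurableSet_Iio] with y hy using le_of_lt hy

theorem negWalk_ae_neg (j : ℕ) : ∀ᵐ y ∂negWalk ν L (j + 1), y < 0 := by
  rw [negWalk]
  filter_upwards [ae_restrict_mem measurableSet_Iio] with y hy using hy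

theorem lintegral_negWalk_succ [IsProbabilityMeasure ν] (hL : Measurable L) (j : ℕ)
    {f : ℝ → ℝ≥0∞} (hf : Measurable f) :
    ∫⁻ y, f y ∂negWalk ν L (j + 1)
      = ∫⁻ y, ∫⁻ x, (if y + L x < 0 then f (y + L x) else 0) ∂ν ∂negWalk ν L j := by
  rw [negWalk, ← lintegral_indicator measurableSet_Iio,
    lintegral_map (hf.indicator measurableSet_Iio) (by fun_prop), lintegral_prod]
  · rfl
  · exact ((hf.indicator measurableSet_Iio).comp (by fun_prop)).aemeasurable

/-- The expected number of steps that a random walk with positive drift needs to return to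
`[0, ∞)` is finite. -/
theorem tsum_negWalk_le [IsProbabilityMeasure ν] (hL : Measurable L) (hi : Integrable L ν) {c : ℝ}
    (hd : 0 ≤ ∫ x, min (L x) c ∂ν) :
    ENNReal.ofReal (∫ x, min (L x) c ∂ν) * ∑' j, negWalk ν L j Set.univ ≤ ENNReal.ofReal c := by
  set δ := ENNReal.ofReal (∫ x, min (L x) c ∂ν) with hδ
  set ψ : ℝ → ℝ≥0∞ := fun y => ENNReal.ofReal (0 - y + c) with hψ
  have hψm : Measurable ψ := by fun_prop
  have h1 : ∀ j, δ * negWalk ν L j Set.univ + ∫⁻ y, ψ y ∂negWalk ν L (j + 1)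
      ≤ ∫⁻ y, ψ y ∂negWalk ν L j := by
    intro j
    rw [lintegral_negWalk_succ ν hL j hψm, ← lintegral_const, ← lintegral_add_left measurable_const]
    refine lintegral_mono_ae ?_
    filter_upwards [negWalk_ae_nonpos ν j] with y hy
    exact wald_step ν hi hd hy
  have h2 : ∀ N, δ * ∑ j ∈ Finset.range N, negWalk ν L j Set.univ + ∫⁻ y, ψ y ∂negWalk ν L N
      ≤ ENNReal.ofReal c := by
    intro N
    induction N with
    | zero =>
      rw [Finset.sum_range_zero, mul_zero, zero_add, negWalk, lintegral_dirac' _ hψm]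
      simp [hψ]
    | succ N ih =>
      rw [Finset.sum_range_succ, mul_add, add_assoc]
      exact (add_le_add le_rfl (h1 N)).trans ih
  rw [← ENNReal.tsum_mul_left]
  refine ENNReal.tsum_le_of_sum_range_le fun N => ?_
  rw [← Finset.mul_sum]
  exact le_self_add.trans (h2 N)

variable (L) in
/-- The expected number of times that a random walk with increments `L` that is started at `w` and
is reflected at `0` attempts to become negative. By time reversal an attempt at time `j + 1` has
the probability that the walk started at `0` is negative at the times `1, …, j + 1` and less than
`-w` at time `j + 1`. -/
noncomputable def undershoots (w : ℝ) : ℝ≥0∞ := ∑' j, negWalk ν L (j + 1) (Set.Iio (-w))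

theorem measurable_undershoots : Measurable (undershoots ν L) := by
  refine Measurable.tsum fun j => ?_
  have : Antitone fun w : ℝ => negWalk ν L (j + 1) (Set.Iio (-w)) :=
    fun a b hab => measure_mono (Set.Iio_subset_Iio (neg_le_neg hab))
  exact this.measurable

theorem undershoots_le (w : ℝ) : undershoots ν L w ≤ ∑' j, negWalk ν L j Set.univ := by
  rw [← tsum_eq_zero_add' ENNReal.summable |>.symm]
  exact (ENNReal.tsum_le_tsum fun j => measure_mono (Set.subset_univ _)).trans le_add_self

/-- `undershoots` solves the renewal inequality of the reflected random walk (in fact with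
equality): both sides are integrals over the pairs of a killed walk and one further increment. -/
theorem lintegral_undershoots_le [IsProbabilityMeasure ν] (hL : Measurable L) {w : ℝ}
    (hw : 0 ≤ w) :
    ∫⁻ x, ((if w + L x < 0 then 1 else 0) + undershoots ν L (max (w + L x) 0)) ∂ν
      ≤ undershoots ν L w := by
  have hs : MeasurableSet {x | w + L x < 0} := measurableSet_lt (by fun_prop) (by fun_prop)
  rw [lintegral_add_left (Measurable.ite hs measurable_const measurable_const)]
  have key : ∀ j, negWalk ν L (j + 1) (Set.Iio (-w))
      = ∫⁻ y, ∫⁻ x, (if y + L x < -w then 1 else 0) ∂ν ∂negWalk ν L j := by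
    intro j
    rw [← lintegral_indicator_one measurableSet_Iio,
      lintegral_negWalk_succ ν hL j (measurable_one.indicator measurableSet_Iio)]
    refine lintegral_congr fun y => lintegral_congr fun x => ?_
    by_cases h : y + L x < -w
    · rw [if_pos (by linarith), if_pos h, Set.indicator_of_mem (by exact h), Pi.one_apply]
    · rw [if_neg h, Set.indicator_of_notMem (by exact h), ite_self]
  unfold undershoots
  rw [lintegral_tsum]
  · rw [tsum_eq_zero_add' (f := fun j => negWalk ν L (j + 1) (Set.Iio (-w))) ENNReal.summable]
    refine add_le_add ?_ (ENNReal.tsum_le_tsum fun j => ?_)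
    · rw [key, negWalk, lintegral_dirac' _ (Measurable.lintegral_prod_right'
        (f := fun z : ℝ × E => if z.1 + L z.2 < -w then (1 : ℝ≥0∞) else 0)
        (Measurable.ite (measurableSet_lt (by fun_prop) (by fun_prop)) measurable_const
          measurable_const))]
      refine lintegral_mono fun x => ?_
      by_cases h : w + L x < 0
      · rw [if_pos h, if_pos (by linarith)]
      · rw [if_neg h]; exact zero_le
    · rw [key (j + 1), lintegral_lintegral_swap]
      · refine lintegral_mono fun x => ?_
        rw [← lintegral_indicator_one measurableSet_Iio]
        refine lintegral_mono_ae ?_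
        filter_upwards [negWalk_ae_neg ν j] with y hy
        by_cases h : y ∈ Set.Iio (-max (w + L x) 0)
        · have h1 : y < -max (w + L x) 0 := h
          have := le_max_left (w + L x) 0
          rw [Set.indicator_of_mem h, if_pos (by linarith), Pi.one_apply]
        · rw [Set.indicator_of_notMem h]; exact zero_le
      · exact (Measurable.ite (measurableSet_lt (by fun_prop) (by fun_prop)) measurable_const
          measurable_const).aemeasurable
  · intro j
    have : Antitone fun w : ℝ => negWalk ν L (j + 1) (Set.Iio (-w)) :=
      fun a b hab => measure_mono (Set.Iio_subset_Iio (neg_le_neg hab))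
    exact (this.measurable.comp (g := fun w : ℝ => negWalk ν L (j + 1) (Set.Iio (-w)))
      (by fun_prop : Measurable fun x => max (w + L x) 0)).aemeasurable

variable (L) in
/-- An upper bound for the expected number of observations that DECuSum skips when its statistic
starts at `w`: an undershoot leads to at most `h / μ + 1` skips. -/
noncomputable def skips (μ h w : ℝ) : ℝ≥0∞ :=
  ENNReal.ofReal (h / μ + 1) * undershoots ν L (max w 0)
    + if w < 0 then ENNReal.ofReal (-w / μ + 1) else 0

theorem measurable_skips (μ h : ℝ) : Measurable (skips ν L μ h) := by
  have := measurable_undershoots ν (L := L)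
  unfold skips
  refine Measurable.add (by fun_prop) (Measurable.ite measurableSet_Iio ?_ ?_) <;> fun_prop

theorem skips_le {μ h w : ℝ} (hμ : 0 < μ) (hw : -h ≤ w) :
    skips ν L μ h w ≤ ENNReal.ofReal (h / μ + 1) * (∑' j, negWalk ν L j Set.univ + 1) := by
  rw [skips, mul_add, mul_one]
  refine add_le_add (mul_le_mul_right (undershoots_le ν _) _) ?_
  split_ifs
  · gcongr; linarith
  · exact zero_le

/-- The potential `skips` does not increase on average when an observation is used. -/
theorem skips_step_nonneg [IsProbabilityMeasure ν] (hL : Measurable L) {μ h w : ℝ} (hμ : 0 < μ)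
    (hh : 0 ≤ h) (hw : 0 ≤ w) :
    ∫⁻ x, skips ν L μ h (max (w + L x) (-h)) ∂ν ≤ skips ν L μ h w := by
  have hU := measurable_undershoots ν (L := L)
  rw [skips, if_neg (not_lt.2 hw), add_zero, max_eq_left hw]
  refine le_trans ?_ (mul_le_mul_right (lintegral_undershoots_le ν hL hw) _)
  have hm : Measurable fun x => (if w + L x < 0 then (1 : ℝ≥0∞) else 0)
      + undershoots ν L (max (w + L x) 0) :=
    (Measurable.ite (measurableSet_lt (by fun_prop) (by fun_prop)) measurable_const
      measurable_const).add (by fun_prop)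
  rw [← lintegral_const_mul _ hm]
  refine lintegral_mono fun x => ?_
  have e : max (max (w + L x) (-h)) 0 = max (w + L x) 0 := by
    rw [max_assoc, max_eq_right (a := -h) (by linarith)]
  dsimp only
  rw [skips, e, mul_add, add_comm]
  gcongr
  split_ifs with h1 h2
  · rw [mul_one]
    gcongr
    have := le_max_right (w + L x) (-h)
    linarith
  · exact absurd ((le_max_left _ _).trans_lt h1) h2
  · exact zero_le
  · exact zero_le

/-- The potential `skips` decreases by at least `1` when an observation is skipped. -/
theorem skips_step_neg {μ h w : ℝ} (hμ : 0 < μ) (hw : w < 0) :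
    1 + skips ν L μ h (min 0 (w + μ)) ≤ skips ν L μ h w := by
  rw [skips, skips, if_pos hw, max_eq_right hw.le, max_eq_right (min_le_left _ _), add_left_comm]
  gcongr
  have h0 : 0 < -w / μ := div_pos (by linarith) hμ
  split_ifs with h1
  · rw [← ENNReal.ofReal_one, ← ENNReal.ofReal_add zero_le_one]
    · refine ENNReal.ofReal_le_ofReal ?_
      have h2 : w + μ < 0 := by
        by_contra! hc
        rw [min_eq_left hc] at h1
        exact lt_irrefl _ h1
      rw [min_eq_right h2.le]
      have : -(w + μ) / μ = -w / μ - 1 := by field_simp; ring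
      linarith
    · have : 0 ≤ -(min 0 (w + μ)) / μ := div_nonneg (by linarith) hμ.le
      linarith
  · rw [add_zero, ← ENNReal.ofReal_one]
    exact ENNReal.ofReal_le_ofReal (by linarith)

end RandomWalk

/-! ### Upper bound for the worst-case delay -/

namespace ChangeModel

variable {E : Type*} [MeasurableSpace E] {Θ : Type*} (m : ChangeModel E Θ)

theorem setLIntegral_path_step (θ : Θ) {γ n : ℕ} (hγ : γ ≤ n + 1) {S : Type*}
    [MeasurableSpace S] {B : Set (ℕ → E)} (hB : MeasurableSet[past n] B) {Z : (ℕ → E) → S}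
    (hZ : Measurable[past n] Z) {g : S → E → ℝ≥0∞} (hg : Measurable (Function.uncurry g)) :
    ∫⁻ ω in B, g (Z ω) (ω (n + 1)) ∂m.path θ γ
      = ∫⁻ ω in B, ∫⁻ x, g (Z ω) x ∂m.P θ ∂m.path θ γ := by
  have h := setLIntegral_step (fun n => if n < γ then m.P₀ else m.P θ) hB hZ hg
  simp only [if_neg (not_lt.2 hγ)] at h
  exact h

theorem neg_le_W {θ : Θ} {μ : ℝ} (hμ : 0 < μ) {h : ℝ≥0∞} (hh : h < ∞) (n : ℕ) (ω : ℕ → E) :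
    -h.toReal ≤ m.W θ μ h n ω := by
  have h0 : 0 ≤ h.toReal := ENNReal.toReal_nonneg
  induction n with
  | zero => simp [W]
  | succ n ih =>
    rw [W_succ, truncBelow, if_neg hh.ne]
    split_ifs
    · exact le_max_right _ _
    · exact le_min (by linarith) (by linarith)

/-- A bound for the expected number of observations that DECuSum for the parameter `s` skips after
the change. -/
noncomputable def skipBound (θ s : Θ) (μ : ℝ) (h : ℝ≥0∞) : ℝ≥0∞ :=
  ENNReal.ofReal (h.toReal / μ + 1) * (∑' j, negWalk (m.P θ) (m.llr s) j Set.univ + 1)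

theorem skipBound_lt_top {s : Θ} (hs : m.LeastFavorable s) (θ : Θ) (μ : ℝ) (h : ℝ≥0∞) :
    m.skipBound θ s μ h < ∞ := by
  have hi : Integrable (m.llr s) (m.P θ) := by
    by_contra hc
    have := hs θ
    rw [integral_undef hc] at this
    exact lt_irrefl _ this
  obtain ⟨c, hc⟩ := ((tendsto_integral_min (m.P θ) hi).eventually (lt_mem_nhds (hs θ))).exists
  have h1 := tsum_negWalk_le (m.P θ) (m.measurable_llr s) hi hc.le
  refine ENNReal.mul_lt_top ENNReal.ofReal_lt_top (ENNReal.add_lt_top.2 ⟨?_, ENNReal.one_lt_top⟩)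
  refine lt_top_iff_ne_top.2 fun htop => ?_
  rw [htop, ENNReal.mul_top (by simpa using hc)] at h1
  exact absurd h1 (by simp)

/-- The expected number of observations that are skipped after time `n₀` is bounded, uniformly in
the past. -/
theorem tsum_path_skipped_le (θ s : Θ) {μ : ℝ} (hμ : 0 < μ) {h : ℝ≥0∞} (hh : h < ∞) {n₀ : ℕ}
    {B : Set (ℕ → E)} (hB : MeasurableSet[past n₀] B) :
    ∑' j, m.path θ (n₀ + 1) ({ω | m.W s μ h (n₀ + j) ω < 0} ∩ B)
      ≤ m.skipBound θ s μ h * m.path θ (n₀ + 1) B := by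
  set V := skips (m.P θ) (m.llr s) μ h.toReal with hV
  have hVm : Measurable V := measurable_skips _ _ _
  have hWm : ∀ n, Measurable (m.W s μ h n) :=
    fun n => (m.measurable_W s μ h n).mono (past_le n) le_rfl
  have hl := m.measurable_llr s
  have hh0 : 0 ≤ h.toReal := ENNReal.toReal_nonneg
  have step : ∀ j, m.path θ (n₀ + 1) ({ω | m.W s μ h (n₀ + j) ω < 0} ∩ B)
      + ∫⁻ ω in B, V (m.W s μ h (n₀ + (j + 1)) ω) ∂m.path θ (n₀ + 1)
      ≤ ∫⁻ ω in B, V (m.W s μ h (n₀ + j) ω) ∂m.path θ (n₀ + 1) := by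
    intro j
    have hneg : MeasurableSet {ω | m.W s μ h (n₀ + j) ω < 0} :=
      measurableSet_lt (hWm _) measurable_const
    have h1 := m.setLIntegral_path_step θ (γ := n₀ + 1) (n := n₀ + j) (by omega)
      (past_mono (Nat.le_add_right n₀ j) _ hB) (m.measurable_W s μ h (n₀ + j))
      (g := fun w x => V (if 0 ≤ w then max (w + m.llr s x) (-h.toReal) else min 0 (w + μ)))
      (by
        unfold Function.uncurry
        refine hVm.comp (Measurable.ite ?_ (by fun_prop) (by fun_prop))
        exact measurableSet_le measurable_const (by fun_prop))
    have h2 : ∀ ω : ℕ → E, m.W s μ h (n₀ + (j + 1)) ω = if 0 ≤ m.W s μ h (n₀ + j) ω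
        then max (m.W s μ h (n₀ + j) ω + m.llr s (ω (n₀ + j + 1))) (-h.toReal)
        else min 0 (m.W s μ h (n₀ + j) ω + μ) := by
      intro ω
      rw [← add_assoc, W_succ, truncBelow, if_neg hh.ne]
    simp only [h2]
    rw [h1, ← Measure.restrict_apply hneg, ← lintegral_indicator_one hneg,
      ← lintegral_add_left (measurable_one.indicator hneg)]
    refine lintegral_mono fun ω => ?_
    dsimp only
    rcases le_or_gt 0 (m.W s μ h (n₀ + j) ω) with h3 | h3
    · rw [Set.indicator_of_notMem (by simpa using h3), zero_add]
      simp only [if_pos h3]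
      exact skips_step_nonneg (m.P θ) hl hμ hh0 h3
    · rw [Set.indicator_of_mem (by exact h3)]
      simp only [if_neg (not_le.2 h3)]
      rw [lintegral_const, measure_univ, mul_one]
      exact skips_step_neg (m.P θ) hμ h3
  have hsum : ∀ N, ∑ j ∈ Finset.range N, m.path θ (n₀ + 1) ({ω | m.W s μ h (n₀ + j) ω < 0} ∩ B)
      + ∫⁻ ω in B, V (m.W s μ h (n₀ + N) ω) ∂m.path θ (n₀ + 1)
      ≤ ∫⁻ ω in B, V (m.W s μ h (n₀ + 0) ω) ∂m.path θ (n₀ + 1) := by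
    intro N
    induction N with
    | zero => simp
    | succ N ih =>
      rw [Finset.sum_range_succ, add_assoc]
      exact (add_le_add le_rfl (step N)).trans ih
  refine ENNReal.tsum_le_of_sum_range_le fun N => le_self_add.trans ((hsum N).trans ?_)
  rw [← setLIntegral_const]
  exact lintegral_mono fun ω => skips_le (m.P θ) hμ (m.neg_le_W hμ hh _ ω)

/-- The paths along which `∑_{i = n₀ + 1}^{n₀ + j'} S i L_θ (X i)` stays below `A` for
`j' ≤ j`. -/
def below (used : ℕ → Set (ℕ → E)) (θ : Θ) (A : ℝ) (n₀ j : ℕ) : Set (ℕ → E) :=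
  {ω | ∀ j' ≤ j, ∑ i ∈ Finset.Ioc n₀ (n₀ + j'), m.usedLLR used θ i ω < A}

theorem mem_below_succ {used : ℕ → Set (ℕ → E)} {θ : Θ} {A : ℝ} {n₀ j : ℕ} {ω : ℕ → E} :
    ω ∈ m.below used θ A n₀ (j + 1) ↔ ω ∈ m.below used θ A n₀ j ∧
      ∑ i ∈ Finset.Ioc n₀ (n₀ + j), m.usedLLR used θ i ω
        + m.usedLLR used θ (n₀ + j + 1) ω < A := by
  have e : ∑ i ∈ Finset.Ioc n₀ (n₀ + (j + 1)), m.usedLLR used θ i ω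
      = ∑ i ∈ Finset.Ioc n₀ (n₀ + j), m.usedLLR used θ i ω
        + m.usedLLR used θ (n₀ + j + 1) ω := by
    rw [← add_assoc, Finset.sum_Ioc_succ_top (by omega)]
  rw [← e]
  constructor
  · exact fun h => ⟨fun j' hj => h j' (by omega), h _ le_rfl⟩
  · rintro ⟨h1, h2⟩ j' hj
    rcases Nat.lt_or_ge j j' with h | h
    · obtain rfl : j' = j + 1 := by omega
      exact h2
    · exact h1 j' h

/-- Wald's inequality for the number of observations that are used after time `n₀` until their log
likelihood ratio reaches `A`, uniformly in the past. -/
theorem tsum_path_used_le (θ s : Θ) (hD : m.D θ < ∞) (μ : ℝ) (h : ℝ≥0∞) {A c : ℝ} (hA : 0 < A)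
    (hc : 0 ≤ ∫ x, min (m.llr θ x) c ∂m.P θ) {n₀ : ℕ}
    {B : Set (ℕ → E)} (hB : MeasurableSet[past n₀] B) :
    ENNReal.ofReal (∫ x, min (m.llr θ x) c ∂m.P θ) * ∑' j, m.path θ (n₀ + 1)
      ({ω | 0 ≤ m.W s μ h (n₀ + j) ω} ∩ (m.below (m.deUsed s μ h) θ A n₀ j ∩ B))
      ≤ ENNReal.ofReal (A + c) * m.path θ (n₀ + 1) B := by
  set δ := ENNReal.ofReal (∫ x, min (m.llr θ x) c ∂m.P θ) with hδ
  set Q := m.path θ (n₀ + 1) with hQ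
  set J : ℕ → Set (ℕ → E) := fun j => m.below (m.deUsed s μ h) θ A n₀ j with hJ
  set a : ℕ → (ℕ → E) → ℝ := fun j ω =>
    ∑ i ∈ Finset.Ioc n₀ (n₀ + j), m.usedLLR (m.deUsed s μ h) θ i ω with ha
  have ham : ∀ j, Measurable[past (n₀ + j)] (a j) := by
    intro j
    have h1 := fun i (hi : i ∈ Finset.Ioc n₀ (n₀ + j)) =>
      m.measurable_past_usedLLR s μ h θ (n := n₀ + j) (k := i)
        (by rw [Finset.mem_Ioc] at hi; omega) (by rw [Finset.mem_Ioc] at hi; omega)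
    let _ := past (E := E) (n₀ + j)
    exact Finset.measurable_sum _ h1
  have hJm : ∀ j, MeasurableSet[past (n₀ + j)] (J j) := by
    intro j
    have e : J j = ⋂ (j' : ℕ) (_ : j' ≤ j), {ω | a j' ω < A} := by
      ext ω; simp [hJ, below, ha]
    have h1 := fun j' (hj : j' ≤ j) =>
      (ham j').mono (past_mono (Nat.add_le_add_left hj n₀)) le_rfl
    rw [e]
    let _ := past (E := E) (n₀ + j)
    exact .iInter fun j' => .iInter fun hj => measurableSet_lt (h1 j' hj) measurable_const
  have hWm : ∀ n, Measurable (m.W s μ h n) :=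
    fun n => (m.measurable_W s μ h n).mono (past_le n) le_rfl
  have hl := m.measurable_llr θ
  have hB' : MeasurableSet B := past_le _ _ hB
  have hJm' : ∀ j, MeasurableSet (J j) := fun j => past_le _ _ (hJm j)
  set ψ : ℝ → ℝ≥0∞ := fun y => ENNReal.ofReal (A - y + c) with hψ
  have hψm : Measurable ψ := by fun_prop
  have step : ∀ j, δ * Q ({ω | 0 ≤ m.W s μ h (n₀ + j) ω} ∩ (J j ∩ B))
      + ∫⁻ ω in J (j + 1) ∩ B, ψ (a (j + 1) ω) ∂Q ≤ ∫⁻ ω in J j ∩ B, ψ (a j ω) ∂Q := by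
    intro j
    have hJB : MeasurableSet[past (n₀ + j)] (J j ∩ B) :=
      @MeasurableSet.inter _ (past (n₀ + j)) _ _ (hJm j) (past_mono (Nat.le_add_right n₀ j) _ hB)
    have hpos : MeasurableSet {ω | 0 ≤ m.W s μ h (n₀ + j) ω} :=
      measurableSet_le measurable_const (hWm _)
    have hZ : Measurable[past (n₀ + j)] fun ω : ℕ → E => (a j ω, m.W s μ h (n₀ + j) ω) := by
      have h1 := ham j
      have h2 := m.measurable_W s μ h (n₀ + j)
      let _ := past (E := E) (n₀ + j)
      exact h1.prodMk h2
    have h1 := m.setLIntegral_path_step θ (γ := n₀ + 1) (n := n₀ + j) (by omega) hJB hZ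
      (g := fun z x => if 0 ≤ z.2 then
        (if z.1 + m.llr θ x < A then ψ (z.1 + m.llr θ x) else 0) else ψ z.1)
      (by
        unfold Function.uncurry
        refine Measurable.ite (measurableSet_le measurable_const (by fun_prop))
          (Measurable.ite (measurableSet_lt (by fun_prop) measurable_const) ?_ ?_) ?_ <;>
        fun_prop)
    have h2 : ∫⁻ ω in J (j + 1) ∩ B, ψ (a (j + 1) ω) ∂Q
        = ∫⁻ ω in J j ∩ B, (if 0 ≤ m.W s μ h (n₀ + j) ω then
          (if a j ω + m.llr θ (ω (n₀ + j + 1)) < A then ψ (a j ω + m.llr θ (ω (n₀ + j + 1)))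
            else 0) else ψ (a j ω)) ∂Q := by
      rw [← lintegral_indicator ((hJm' _).inter hB'), ← lintegral_indicator ((hJm' _).inter hB')]
      refine lintegral_congr fun ω => ?_
      have e : a (j + 1) ω = a j ω + m.usedLLR (m.deUsed s μ h) θ (n₀ + j + 1) ω := by
        simp only [ha]
        rw [← add_assoc, Finset.sum_Ioc_succ_top (by omega)]
      by_cases hω : ω ∈ J j ∩ B
      · rw [Set.indicator_of_mem hω]
        have hmem : ω ∈ J (j + 1) ∩ B
            ↔ a j ω + m.usedLLR (m.deUsed s μ h) θ (n₀ + j + 1) ω < A := by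
          rw [Set.mem_inter_iff, and_iff_left hω.2]
          exact m.mem_below_succ.trans (and_iff_right hω.1)
        rcases le_or_gt 0 (m.W s μ h (n₀ + j) ω) with h3 | h3
        · have e2 : m.usedLLR (m.deUsed s μ h) θ (n₀ + j + 1) ω = m.llr θ (ω (n₀ + j + 1)) := by
            rw [usedLLR, if_pos (m.mem_deUsed_succ.2 h3)]
          rw [e2] at e hmem
          rw [if_pos h3]
          by_cases h4 : a j ω + m.llr θ (ω (n₀ + j + 1)) < A
          · rw [if_pos h4, Set.indicator_of_mem (hmem.2 h4), e]
          · rw [if_neg h4, Set.indicator_of_notMem (fun hc => h4 (hmem.1 hc))]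
        · have e2 : m.usedLLR (m.deUsed s μ h) θ (n₀ + j + 1) ω = 0 := by
            rw [usedLLR, if_neg (fun hc => absurd (m.mem_deUsed_succ.1 hc) (not_le.2 h3))]
          rw [e2, add_zero] at e hmem
          rw [if_neg (not_le.2 h3), Set.indicator_of_mem (hmem.2 (hω.1 j le_rfl)), e]
      · rw [Set.indicator_of_notMem hω, Set.indicator_of_notMem]
        exact fun hc => hω ⟨(m.mem_below_succ.1 hc.1).1, hc.2⟩
    rw [h2, h1, ← Measure.restrict_apply hpos, ← lintegral_indicator_one hpos,
      ← lintegral_const_mul _ (measurable_one.indicator hpos),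
      ← lintegral_add_left ((measurable_one.indicator hpos).const_mul _)]
    refine setLIntegral_mono' ((hJm' j).inter hB') fun ω hω => ?_
    rcases le_or_gt 0 (m.W s μ h (n₀ + j) ω) with h3 | h3
    · rw [Set.indicator_of_mem (by exact h3), Pi.one_apply, mul_one]
      simp only [if_pos h3]
      exact wald_step (m.P θ) (m.integrable_llr hD) hc (hω.1 j le_rfl : a j ω < A).le
    · rw [Set.indicator_of_notMem (by simpa using h3), mul_zero, zero_add]
      simp only [if_neg (not_le.2 h3)]
      rw [lintegral_const, measure_univ, mul_one]
  have hsum : ∀ N, δ * ∑ j ∈ Finset.range N, Q ({ω | 0 ≤ m.W s μ h (n₀ + j) ω} ∩ (J j ∩ B))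
      + ∫⁻ ω in J N ∩ B, ψ (a N ω) ∂Q ≤ ENNReal.ofReal (A + c) * Q B := by
    intro N
    induction N with
    | zero =>
      have e : J 0 = Set.univ := Set.eq_univ_of_forall fun ω j' hj => by
        rw [Nat.le_zero.1 hj]; simpa using hA
      simp [e, ha, hψ]
    | succ N ih =>
      rw [Finset.sum_range_succ, mul_add, add_assoc]
      exact (add_le_add le_rfl (step N)).trans ih
  rw [← ENNReal.tsum_mul_left]
  refine ENNReal.tsum_le_of_sum_range_le fun N => ?_
  rw [← Finset.mul_sum]
  exact le_self_add.trans (hsum N)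

/-- The delay is the number of observations used plus the number skipped. GDECuSum stops no later
than the test that accumulates `L_θ` from the change point on. -/
theorem setLIntegral_delay_le [Finite Θ] (θ s : Θ) (hD : m.D θ < ∞) {μ : ℝ} (hμ : 0 < μ)
    {h : ℝ≥0∞} (hh : h < ∞) {A c : ℝ} (hA : 0 < A) (hc : 0 < ∫ x, min (m.llr θ x) c ∂m.P θ)
    {n₀ : ℕ} {B : Set (ℕ → E)} (hB : MeasurableSet[past n₀] B) :
    ∫⁻ ω in B, (((m.GDECuSum s μ h A).τ ω : ℝ≥0∞) - ((n₀ + 1 : ℕ) : ℝ≥0∞)) ∂m.path θ (n₀ + 1)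
      ≤ (ENNReal.ofReal ((A + c) / ∫ x, min (m.llr θ x) c ∂m.P θ) + m.skipBound θ s μ h)
        * m.path θ (n₀ + 1) B := by
  have : Nonempty Θ := ⟨s⟩
  rw [setLIntegral_tau_sub (m.admissible_GDECuSum s μ h A)]
  set Q := m.path θ (n₀ + 1) with hQ
  set used := m.deUsed s μ h with hused
  have hWm : ∀ n, Measurable (m.W s μ h n) :=
    fun n => (m.measurable_W s μ h n).mono (past_le n) le_rfl
  have h1 : ∀ j : ℕ, {ω | ((n₀ + j : ℕ) : ℕ∞) < (m.GDECuSum s μ h A).τ ω}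
      ⊆ m.below used θ A n₀ j := by
    intro j ω hω j' hj'
    rcases Nat.eq_zero_or_pos j' with rfl | hpos
    · simpa using hA
    · have h2 := lt_firstPassage_iff.1 hω (n₀ + j') (by omega) (by omega)
      rw [← not_le, m.le_glr_iff (by omega)] at h2
      by_contra! hcon
      refine h2 ⟨n₀ + 1, by omega, by omega, θ, ?_⟩
      have e : Finset.Icc (n₀ + 1) (n₀ + j') = Finset.Ioc n₀ (n₀ + j') := by
        ext i; simp only [Finset.mem_Icc, Finset.mem_Ioc]; omega
      rw [e]
      exact hcon
  have h2 : ∀ j : ℕ, Q ({ω | ((n₀ + j : ℕ) : ℕ∞) < (m.GDECuSum s μ h A).τ ω} ∩ B)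
      ≤ Q ({ω | 0 ≤ m.W s μ h (n₀ + j) ω} ∩ (m.below used θ A n₀ j ∩ B))
        + Q ({ω | m.W s μ h (n₀ + j) ω < 0} ∩ B) := by
    intro j
    refine (measure_mono ?_).trans (measure_union_le _ _)
    rintro ω ⟨hω, hωB⟩
    rcases le_or_gt 0 (m.W s μ h (n₀ + j) ω) with h3 | h3
    · exact Or.inl ⟨h3, h1 j hω, hωB⟩
    · exact Or.inr ⟨h3, hωB⟩
  have h3 : ∑' j, Q ({ω | 0 ≤ m.W s μ h (n₀ + j) ω} ∩ (m.below used θ A n₀ j ∩ B))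
      ≤ ENNReal.ofReal ((A + c) / ∫ x, min (m.llr θ x) c ∂m.P θ) * Q B := by
    have h4 := m.tsum_path_used_le θ s hD μ h hA hc.le hB
    rw [ENNReal.ofReal_div_of_pos hc, ← ENNReal.mul_div_right_comm,
      ENNReal.le_div_iff_mul_le (by simp [hc]) (by simp), mul_comm]
    exact h4
  calc ∑' n : ℕ, Q ({ω | ((n₀ + 1 + n : ℕ) : ℕ∞) < (m.GDECuSum s μ h A).τ ω} ∩ B)
      = ∑' n : ℕ, Q ({ω | ((n₀ + (n + 1) : ℕ) : ℕ∞) < (m.GDECuSum s μ h A).τ ω} ∩ B) := by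
        refine tsum_congr fun n => ?_
        rw [show n₀ + 1 + n = n₀ + (n + 1) by omega]
    _ ≤ ∑' n : ℕ, Q ({ω | ((n₀ + n : ℕ) : ℕ∞) < (m.GDECuSum s μ h A).τ ω} ∩ B) :=
        ENNReal.tsum_comp_le_tsum_of_injective (add_left_injective 1)
          (fun n : ℕ => Q ({ω | ((n₀ + n : ℕ) : ℕ∞) < (m.GDECuSum s μ h A).τ ω} ∩ B))
    _ ≤ _ := ENNReal.tsum_le_tsum h2
    _ ≤ _ := by
        rw [ENNReal.tsum_add, add_mul]
        exact add_le_add h3 (m.tsum_path_skipped_le θ s hμ hh hB)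

theorem essSup_condLExp_le {Ω : Type*} {m₁ m₀ : MeasurableSpace Ω} (hm : m₁ ≤ m₀)
    (Q : Measure[m₀] Ω) [IsFiniteMeasure Q] {f : Ω → ℝ≥0∞} {C : ℝ≥0∞}
    (h : ∀ B, MeasurableSet[m₁] B → ∫⁻ ω in B, f ω ∂Q ≤ C * Q B) :
    essSup (condLExp m₁ Q f) Q ≤ C := by
  refine essSup_le_of_ae_le C ?_
  refine ae_le_of_ae_le_trim (hm := hm) ?_
  refine ae_le_of_forall_setLIntegral_le_of_sigmaFinite (μ := Q.trim hm)
    (measurable_condLExp _ _ _) ?_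
  intro B hB _
  rw [setLIntegral_condLExp_trim hm _ _ hB, setLIntegral_const, trim_measurableSet_eq hm hB]
  exact h B hB

theorem WADD_GDECuSum_le [Finite Θ] (θ s : Θ) (hD : m.D θ < ∞) {μ : ℝ} (hμ : 0 < μ)
    {h : ℝ≥0∞} (hh : h < ∞) {A c : ℝ} (hA : 0 < A) (hc : 0 < ∫ x, min (m.llr θ x) c ∂m.P θ) :
    m.WADD θ (m.GDECuSum s μ h A)
      ≤ ENNReal.ofReal ((A + c) / ∫ x, min (m.llr θ x) c ∂m.P θ) + m.skipBound θ s μ h := by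
  refine iSup₂_le fun γ hγ => ?_
  obtain ⟨n₀, rfl⟩ : ∃ n, γ = n + 1 := ⟨γ - 1, by omega⟩
  have hadm := m.admissible_GDECuSum s μ h A
  rw [Nat.add_sub_cancel]
  exact essSup_condLExp_le ((hadm.info_le n₀).trans (past_le n₀)) _ fun B hB =>
    m.setLIntegral_delay_le θ s hD hμ hh hA hc (hadm.info_le n₀ _ hB)

/-- The conditional average delay is at most the worst-case delay, because `τ ≥ γ` is decided by
the information at time `γ - 1`. -/
theorem CADD_le_WADD (θ : Θ) {Ψ : Policy E} (hΨ : Ψ.Admissible) : m.CADD θ Ψ ≤ m.WADD θ Ψ := by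
  refine iSup₂_mono fun γ hγ => ?_
  obtain ⟨n₀, rfl⟩ : ∃ n, γ = n + 1 := ⟨γ - 1, by omega⟩
  rw [Nat.add_sub_cancel]
  have hm := (hΨ.info_le n₀).trans (past_le n₀)
  set B := {ω | ((n₀ + 1 : ℕ) : ℕ∞) ≤ Ψ.τ ω} with hB
  have e : B = {ω | (n₀ : ℕ∞) < Ψ.τ ω} := by
    ext ω
    simp only [hB, Set.mem_ofPred_eq]
    rw [Nat.cast_add, Nat.cast_one, ENat.add_one_le_iff (ENat.natCast_ne_top n₀)]
  have hBm : MeasurableSet[info Ψ.used n₀] B := e ▸ hΨ.measurableSet_lt n₀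
  set Q := m.path θ (n₀ + 1)
  set f : (ℕ → E) → ℝ≥0∞ := fun ω => (Ψ.τ ω : ℝ≥0∞) - ((n₀ + 1 : ℕ) : ℝ≥0∞) with hf
  rw [ProbabilityTheory.cond, lintegral_smul_measure, smul_eq_mul,
    ← setLIntegral_condLExp hm Q f hBm]
  calc (Q B)⁻¹ * ∫⁻ ω in B, condLExp (info Ψ.used n₀) Q f ω ∂Q
      ≤ (Q B)⁻¹ * ∫⁻ ω in B, essSup (condLExp (info Ψ.used n₀) Q f) Q ∂Q := by
        exact mul_le_mul_right
          (lintegral_mono_ae (ae_restrict_of_ae (ENNReal.ae_le_essSup _))) _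
    _ = (Q B)⁻¹ * Q B * essSup (condLExp (info Ψ.used n₀) Q f) Q := by
        rw [setLIntegral_const]; ring
    _ ≤ _ := mul_le_of_le_one_left zero_le (ENNReal.inv_mul_le_one _)

end ChangeModel

/-! ### The pre-change duty cycle -/

namespace ChangeModel

variable {E : Type*} [MeasurableSpace E] {Θ : Type*} (m : ChangeModel E Θ)

/-- The potential `W n + h` decreases by at least `d = -E_∞[max (L (X 1)) (-h)]` on average when an
observation is used, and increases by at most `μ` when it is skipped. -/
theorem sum_pathInf_used_le {s : Θ} (hi : Integrable (m.llr s) m.P₀) {μ h : ℝ} (hμ : 0 < μ)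
    (hh : 0 ≤ h) (hd : 0 < ∫ x, min (-m.llr s x) h ∂m.P₀) (N : ℕ) :
    ∑ n ∈ Finset.range N, m.pathInf {ω | 0 ≤ m.W s μ (ENNReal.ofReal h) n ω}
      ≤ ENNReal.ofReal ((h + N * μ) / ∫ x, min (-m.llr s x) h ∂m.P₀) := by
  set d := ∫ x, min (-m.llr s x) h ∂m.P₀ with hd'
  set W := m.W s μ (ENNReal.ofReal h) with hW
  have hl := m.measurable_llr s
  have hWm : ∀ n, Measurable (W n) := fun n =>
    (m.measurable_W s μ (ENNReal.ofReal h) n).mono (past_le n) le_rfl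
  have hWge : ∀ n ω, -h ≤ W n ω := fun n ω => by
    have := m.neg_le_W (θ := s) hμ (h := ENNReal.ofReal h) ENNReal.ofReal_lt_top n ω
    rwa [ENNReal.toReal_ofReal hh] at this
  have step : ∀ n, ENNReal.ofReal d * m.pathInf {ω | 0 ≤ W n ω}
      + ∫⁻ ω, ENNReal.ofReal (W (n + 1) ω + h) ∂m.pathInf
      ≤ ∫⁻ ω, ENNReal.ofReal (W n ω + h) ∂m.pathInf + ENNReal.ofReal μ := by
    intro n
    have hpos : MeasurableSet {ω | 0 ≤ W n ω} := measurableSet_le measurable_const (hWm n)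
    have h1 := lintegral_step (fun _ => m.P₀) (m.measurable_W s μ (ENNReal.ofReal h) n)
      (g := fun w x => ENNReal.ofReal
        ((if 0 ≤ w then max (w + m.llr s x) (-h) else min 0 (w + μ)) + h))
      (by
        unfold Function.uncurry
        refine ENNReal.measurable_ofReal.comp (Measurable.add_const (Measurable.ite
          (measurableSet_le measurable_const (by fun_prop)) ?_ ?_) _) <;> fun_prop)
    have h2 : ∀ ω : ℕ → E, W (n + 1) ω = if 0 ≤ W n ω
        then max (W n ω + m.llr s (ω (n + 1))) (-h) else min 0 (W n ω + μ) := by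
      intro ω
      rw [hW, W_succ, truncBelow, if_neg ENNReal.ofReal_ne_top, ENNReal.toReal_ofReal hh]
    have h3 : ∫⁻ ω, ENNReal.ofReal (W (n + 1) ω + h) ∂m.pathInf
        = ∫⁻ ω, ∫⁻ x, ENNReal.ofReal ((if 0 ≤ W n ω then max (W n ω + m.llr s x) (-h)
          else min 0 (W n ω + μ)) + h) ∂m.P₀ ∂m.pathInf := by
      simp only [h2]
      exact h1
    have e : ∫⁻ _, ENNReal.ofReal μ ∂m.pathInf = ENNReal.ofReal μ := by simp
    rw [h3, ← e, ← lintegral_indicator_one hpos,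
      ← lintegral_const_mul _ (measurable_one.indicator hpos),
      ← lintegral_add_left ((measurable_one.indicator hpos).const_mul _),
      ← lintegral_add_right _ measurable_const]
    refine lintegral_mono fun ω => ?_
    dsimp only
    have hge := hWge n ω
    rcases le_or_gt 0 (W n ω) with h4 | h4
    · rw [Set.indicator_of_mem (by exact h4), Pi.one_apply, mul_one]
      simp only [if_pos h4]
      have hmi : Integrable (fun x => min (-m.llr s x) h) m.P₀ :=
        integrable_min_const m.P₀ hi.neg h
      have h5 : ∫⁻ x, ENNReal.ofReal (max (W n ω + m.llr s x) (-h) + h) ∂m.P₀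
          ≤ ENNReal.ofReal (W n ω + h - d) := by
        have e2 : W n ω + h - d = ∫ x, (W n ω + h - min (-m.llr s x) h) ∂m.P₀ := by
          rw [integral_sub (integrable_const _) hmi]
          simp [hd']
        have hi2 : Integrable (fun x => W n ω + h - min (-m.llr s x) h) m.P₀ :=
          (integrable_const _).sub hmi
        rw [e2, ofReal_integral_eq_lintegral_ofReal hi2]
        · refine lintegral_mono fun x => ENNReal.ofReal_le_ofReal ?_
          rcases le_total (W n ω + m.llr s x) (-h) with h6 | h6
          · rw [max_eq_right h6]
            have := min_le_right (-m.llr s x) h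
            linarith
          · rw [max_eq_left h6]
            have := min_le_left (-m.llr s x) h
            linarith
        · refine Eventually.of_forall fun x => ?_
          have := min_le_right (-m.llr s x) h
          simp only [Pi.zero_apply]
          linarith
      have h6 : d ≤ h := integral_min_const_le m.P₀ hi.neg h
      calc _ ≤ ENNReal.ofReal d + ENNReal.ofReal (W n ω + h - d) := by gcongr
        _ = ENNReal.ofReal (W n ω + h) := by
          rw [← ENNReal.ofReal_add hd.le (by linarith)]
          congr 1; ring
        _ ≤ _ := le_self_add
    · rw [Set.indicator_of_notMem (by simpa using h4), mul_zero, zero_add]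
      simp only [if_neg (not_le.2 h4)]
      rw [lintegral_const, measure_univ, mul_one, ← ENNReal.ofReal_add (by linarith) hμ.le]
      refine ENNReal.ofReal_le_ofReal ?_
      have := min_le_right 0 (W n ω + μ)
      linarith
  have hsum : ENNReal.ofReal d * ∑ n ∈ Finset.range N, m.pathInf {ω | 0 ≤ W n ω}
      + ∫⁻ ω, ENNReal.ofReal (W N ω + h) ∂m.pathInf ≤ ENNReal.ofReal (h + N * μ) := by
    induction N with
    | zero => simp [hW, ChangeModel.W]
    | succ N ih =>
      rw [Finset.sum_range_succ, mul_add, add_assoc]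
      calc _ ≤ ENNReal.ofReal d * ∑ n ∈ Finset.range N, m.pathInf {ω | 0 ≤ W n ω}
            + (∫⁻ ω, ENNReal.ofReal (W N ω + h) ∂m.pathInf + ENNReal.ofReal μ) :=
            add_le_add le_rfl (step N)
        _ ≤ ENNReal.ofReal (h + N * μ) + ENNReal.ofReal μ := by
            rw [← add_assoc]; exact add_le_add ih le_rfl
        _ = _ := by
            rw [← ENNReal.ofReal_add (by positivity) hμ.le]
            congr 1; push_cast; ring
  rw [ENNReal.ofReal_div_of_pos hd, ENNReal.le_div_iff_mul_le (by simp [hd]) (by simp), mul_comm]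
  exact le_self_add.trans hsum

theorem PDC_DECuSum_le {s : Θ} (hi : Integrable (m.llr s) m.P₀) {μ h : ℝ} (hμ : 0 < μ)
    (hh : 0 ≤ h) (hd : 0 < ∫ x, min (-m.llr s x) h ∂m.P₀) (A : ℝ) :
    m.PDC (m.DECuSum s μ (ENNReal.ofReal h) A)
      ≤ ENNReal.ofReal (μ / ∫ x, min (-m.llr s x) h ∂m.P₀) := by
  set d := ∫ x, min (-m.llr s x) h ∂m.P₀ with hd'
  have hWm : ∀ n, Measurable (m.W s μ (ENNReal.ofReal h) n) := fun n =>
    (m.measurable_W s μ (ENNReal.ofReal h) n).mono (past_le n) le_rfl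
  have hum : ∀ n, MeasurableSet (m.deUsed s μ (ENNReal.ofReal h) n) := fun n =>
    measurableSet_le measurable_const (hWm _)
  have hbound : ∀ᶠ γ : ℕ in atTop, ∫⁻ ω, (∑ n ∈ Finset.Ico 1 γ,
      (m.deUsed s μ (ENNReal.ofReal h) n).indicator 1 ω) / (γ : ℝ≥0∞) ∂m.pathInf
      ≤ ENNReal.ofReal (h / d * (γ : ℝ)⁻¹ + μ / d) := by
    filter_upwards [eventually_gt_atTop 0] with γ hγ
    have hγ' : (0 : ℝ) < γ := by exact_mod_cast hγ
    simp_rw [div_eq_mul_inv (b := (γ : ℝ≥0∞))]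
    rw [lintegral_mul_const _ (Finset.measurable_sum _ fun n _ =>
      measurable_one.indicator (hum n)), lintegral_finsetSum _ (fun n _ =>
      measurable_one.indicator (hum n))]
    simp_rw [lintegral_indicator_one (hum _)]
    have h1 : ∑ n ∈ Finset.Ico 1 γ, m.pathInf (m.deUsed s μ (ENNReal.ofReal h) n)
        ≤ ENNReal.ofReal ((h + γ * μ) / d) := by
      rw [Finset.sum_Ico_eq_sum_range]
      refine le_trans ?_ (m.sum_pathInf_used_le hi hμ hh hd γ)
      refine le_trans (Finset.sum_le_sum_of_subset
        (Finset.range_subset_range.2 (Nat.sub_le γ 1))) ?_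
      refine Finset.sum_le_sum fun n _ => le_of_eq ?_
      rw [deUsed, Nat.add_sub_cancel_left]
    rw [← div_eq_mul_inv]
    refine (ENNReal.div_le_div_right h1 _).trans (le_of_eq ?_)
    rw [← ENNReal.ofReal_natCast, ← ENNReal.ofReal_div_of_pos hγ']
    congr 1
    field_simp
  have hlim : Tendsto (fun γ : ℕ => ENNReal.ofReal (h / d * (γ : ℝ)⁻¹ + μ / d)) atTop
      (𝓝 (ENNReal.ofReal (μ / d))) := by
    refine ENNReal.tendsto_ofReal ?_
    have := ((tendsto_inv_atTop_nhds_zero_nat (𝕜 := ℝ)).const_mul (h / d)).add_const (μ / d)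
    simpa using this
  rw [PDC, ← hlim.limsup_eq]
  exact limsup_le_limsup hbound

theorem exists_PDC_DECuSum_le {s : Θ} (hD : m.D s < ∞) (hD' : 0 < m.D' s ∧ m.D' s < ∞) {β : ℝ}
    (hβ : 0 < β) :
    ∃ (μ : ℝ) (h : ℝ≥0∞), 0 < μ ∧ h < ∞ ∧
      ∀ A : ℝ, m.PDC (m.DECuSum s μ h A) ≤ ENNReal.ofReal β := by
  have hi := m.integrable_llr_P₀ hD hD'.2
  have hpos : 0 < ∫ x, -m.llr s x ∂m.P₀ := by
    rw [integral_neg, m.integral_llr_P₀ hD hD'.2, neg_neg]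
    exact ENNReal.toReal_pos hD'.1.ne' hD'.2.ne
  obtain ⟨h, hd, hh⟩ : ∃ h : ℝ, 0 < ∫ x, min (-m.llr s x) h ∂m.P₀ ∧ 0 ≤ h :=
    (((tendsto_integral_min m.P₀ hi.neg).eventually
    (lt_mem_nhds hpos)).and (eventually_ge_atTop 0)).exists
  refine ⟨β * ∫ x, min (-m.llr s x) h ∂m.P₀, ENNReal.ofReal h, mul_pos hβ hd,
    ENNReal.ofReal_lt_top, fun A => ?_⟩
  have := m.PDC_DECuSum_le hi (mul_pos hβ hd) hh hd A
  rwa [mul_div_cancel_right₀ _ hd.ne'] at this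

end ChangeModel

/-! ### Lower bound for the conditional average delay -/

section RandomWalk

variable {E : Type*} [MeasurableSpace E] (P : Measure E) (L : E → ℝ)

/-- The probability that a random walk with increments `L` started at `a` exceeds `C` after `j`
steps. -/
noncomputable def walkTail (C : ℝ) : ℕ → ℝ → ℝ≥0∞
  | 0, a => (Set.Ioi C).indicator 1 a
  | j + 1, a => ∫⁻ x, walkTail C j (a + L x) ∂P

variable {L} [IsProbabilityMeasure P]

theorem measurable_walkTail (hL : Measurable L) (C : ℝ) (j : ℕ) :
    Measurable (walkTail P L C j) := by
  induction j with
  | zero => exact measurable_one.indicator measurableSet_Ioi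
  | succ j ih =>
    exact Measurable.lintegral_prod_right' (f := fun z : ℝ × E => walkTail P L C j (z.1 + L z.2))
      (ih.comp (by fun_prop))

/-- The sum of the `k` observations after time `n₀` is independent of the past, and its law does
not depend on `n₀`. -/
theorem measure_sum_gt_inter (hL : Measurable L) (ν : ℕ → Measure E)
    [∀ i, IsProbabilityMeasure (ν i)] {n₀ : ℕ} (hν : ∀ i, n₀ < i → ν i = P)
    {B : Set (ℕ → E)} (hB : MeasurableSet[past n₀] B) (C : ℝ) (k : ℕ) :
    Measure.infinitePi ν ({ω | C < ∑ i ∈ Finset.Ioc n₀ (n₀ + k), L (ω i)} ∩ B)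
      = walkTail P L C k 0 * Measure.infinitePi ν B := by
  set a : ℕ → (ℕ → E) → ℝ := fun j ω => ∑ i ∈ Finset.Ioc n₀ (n₀ + j), L (ω i) with ha
  have ham : ∀ j, Measurable[past (n₀ + j)] (a j) := by
    intro j
    refine @Finset.measurable_sum _ _ _ _ _ _ (past (n₀ + j)) _ _ fun i hi => ?_
    rw [Finset.mem_Ioc] at hi
    exact hL.comp (measurable_past_eval (by omega) (by omega))
  have step : ∀ r j, ∫⁻ ω in B, walkTail P L C r (a (j + 1) ω) ∂Measure.infinitePi ν
      = ∫⁻ ω in B, walkTail P L C (r + 1) (a j ω) ∂Measure.infinitePi ν := by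
    intro r j
    have hw := measurable_walkTail P hL C r
    have h1 := setLIntegral_step ν (past_mono (Nat.le_add_right n₀ j) _ hB) (ham j)
      (g := fun y x => walkTail P L C r (y + L x)) (hw.comp (by fun_prop))
    rw [hν _ (by omega)] at h1
    rw [show ∫⁻ ω in B, walkTail P L C (r + 1) (a j ω) ∂Measure.infinitePi ν = _ from h1.symm]
    refine lintegral_congr fun ω => ?_
    congr 1
    simp only [ha]
    rw [← add_assoc, Finset.sum_Ioc_succ_top (by omega)]
  have h2 : ∀ j, j ≤ k → ∫⁻ ω in B, walkTail P L C (k - j) (a j ω) ∂Measure.infinitePi ν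
      = walkTail P L C k 0 * Measure.infinitePi ν B := by
    intro j
    induction j with
    | zero => intro _; simp [ha]
    | succ j ih =>
      intro hj
      rw [← ih (by omega), step, show k - (j + 1) + 1 = k - j by omega]
  have h3 := h2 k le_rfl
  have hs : MeasurableSet {ω | C < a k ω} :=
    measurableSet_lt measurable_const ((ham k).mono (past_le _) le_rfl)
  rw [← h3, ← Measure.restrict_apply hs, ← lintegral_indicator_one hs, Nat.sub_self]
  rfl

theorem walkTail_zero_eq (hL : Measurable L) (C : ℝ) (k : ℕ) :
    walkTail P L C k 0
      = Measure.infinitePi (fun _ : ℕ => P) {ω | C < ∑ i ∈ Finset.range k, L (ω (i + 1))} := by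
  have h := measure_sum_gt_inter P hL (fun _ => P) (n₀ := 0) (fun _ _ => rfl)
    (@MeasurableSet.univ _ (past 0)) C k
  rw [measure_univ, mul_one, Set.inter_univ] at h
  rw [← h]
  congr 1
  ext ω
  have e : Finset.Ioc 0 (0 + k) = Finset.Ico 1 (k + 1) := by
    ext i; simp only [Finset.mem_Ioc, Finset.mem_Ico]; omega
  rw [Set.mem_ofPred_eq, Set.mem_ofPred_eq, e, Finset.sum_Ico_eq_sum_range]
  simp [add_comm]

theorem tendsto_walkTail (hL : Measurable L) (hi : Integrable L P) {c : ℝ}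
    (hc : ∫ x, L x ∂P < c) :
    Tendsto (fun k : ℕ => walkTail P L (c * k) k 0) atTop (𝓝 0) := by
  set Q := Measure.infinitePi fun _ : ℕ => P with hQ
  set X : ℕ → (ℕ → E) → ℝ := fun i ω => L (ω (i + 1)) with hX
  have hmp : ∀ i, MeasurePreserving (fun ω : ℕ → E => ω i) Q P := fun i =>
    measurePreserving_eval_infinitePi (fun _ : ℕ => P) i
  have hXm : ∀ i, Measurable (X i) := fun i => hL.comp (measurable_pi_apply _)
  have hI : ProbabilityTheory.iIndepFun (fun (i : ℕ) (ω : ℕ → E) => L (ω i)) Q :=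
    ProbabilityTheory.iIndepFun_infinitePi (X := fun _ => L) fun _ => hL
  have h1 := ProbabilityTheory.strong_law_ae_real X
    ((hmp 1).integrable_comp_of_integrable hi)
    (fun i j hij => hI.indepFun (by omega : i + 1 ≠ j + 1))
    (fun i => ⟨(hXm i).aemeasurable, (hXm 0).aemeasurable, by
      have : ∀ i, Q.map (X i) = P.map L := fun i => by
        rw [← (hmp (i + 1)).map_eq, Measure.map_map hL (measurable_pi_apply _)]
        rfl
      rw [this, this]⟩)
  have e : ∫ ω, X 0 ω ∂Q = ∫ x, L x ∂P := by
    rw [← (hmp 1).map_eq, integral_map (measurable_pi_apply 1).aemeasurable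
      hL.aestronglyMeasurable]
  rw [e] at h1
  have h2 := tendstoInMeasure_of_tendsto_ae (fun n => (Measurable.div_const
    (Finset.measurable_sum _ fun i _ => hXm i) _).aestronglyMeasurable) h1
  rw [tendstoInMeasure_iff_dist] at h2
  refine tendsto_of_tendsto_of_tendsto_of_le_of_le' tendsto_const_nhds
    (h2 (c - ∫ x, L x ∂P) (by linarith)) (Eventually.of_forall fun _ => zero_le) ?_
  filter_upwards [eventually_gt_atTop 0] with k hk
  have hk' : (0 : ℝ) < k := by exact_mod_cast hk
  rw [walkTail_zero_eq P hL]
  refine measure_mono fun ω hω => ?_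
  rw [Set.mem_ofPred_eq] at hω ⊢
  have h3 : c < (∑ i ∈ Finset.range k, X i ω) / k := (lt_div_iff₀ hk').2 hω
  rw [Real.dist_eq]
  exact (le_abs_self _).trans' (by linarith)

end RandomWalk

namespace ChangeModel

variable {E : Type*} [MeasurableSpace E] {Θ : Type*} (m : ChangeModel E Θ)

/-- A stopping time with a large mean survives some block of `k` consecutive times with a
conditional probability close to `1`. -/
theorem exists_survival_block {Ψ : Policy E} (hΨ : Ψ.Admissible) {α : ℝ} (hα : 0 < α)
    (hF : m.FAR Ψ ≤ ENNReal.ofReal α) {k : ℕ} {q : ℝ} (hq : 0 < q) (hkq : k / q < α⁻¹) :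
    ∃ n₀ : ℕ, (1 - q) * m.pathInf.real {ω | (n₀ : ℕ∞) < Ψ.τ ω}
      < m.pathInf.real {ω | ((n₀ + k : ℕ) : ℕ∞) < Ψ.τ ω} := by
  by_contra! hcon
  set p : ℕ → ℝ := fun n => m.pathInf.real {ω | (n : ℕ∞) < Ψ.τ ω} with hp
  have hp1 : ∀ n, p n ≤ 1 := fun n => measureReal_le_one
  have hp0 : ∀ n, 0 ≤ p n := fun n => measureReal_nonneg
  have hS : ∀ N, ∑ n ∈ Finset.range N, p n ≤ k / q := by
    intro N
    have h1 : ∑ n ∈ Finset.range N, p n ≤ k + ∑ n ∈ Finset.range N, p (n + k) := by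
      calc ∑ n ∈ Finset.range N, p n ≤ ∑ n ∈ Finset.range (k + N), p n :=
            Finset.sum_le_sum_of_subset_of_nonneg (Finset.range_subset_range.2 (by omega))
              fun n _ _ => hp0 n
        _ = ∑ n ∈ Finset.range k, p n + ∑ n ∈ Finset.range N, p (k + n) :=
            Finset.sum_range_add _ _ _
        _ ≤ _ := by
            refine add_le_add ?_ (le_of_eq (Finset.sum_congr rfl fun n _ => by rw [add_comm]))
            calc ∑ n ∈ Finset.range k, p n ≤ ∑ n ∈ Finset.range k, (1 : ℝ) :=
                  Finset.sum_le_sum fun n _ => hp1 n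
              _ = k := by simp
    have h2 : ∑ n ∈ Finset.range N, p (n + k) ≤ (1 - q) * ∑ n ∈ Finset.range N, p n := by
      rw [Finset.mul_sum]
      exact Finset.sum_le_sum fun n _ => hcon n
    rw [le_div_iff₀ hq]
    nlinarith
  have hE : ∫⁻ ω, (Ψ.τ ω : ℝ≥0∞) ∂m.pathInf ≤ ENNReal.ofReal (k / q) := by
    rw [lintegral_tau hΨ]
    refine ENNReal.tsum_le_of_sum_range_le fun N => ?_
    calc ∑ n ∈ Finset.range N, m.pathInf {ω | (n : ℕ∞) < Ψ.τ ω}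
        = ∑ n ∈ Finset.range N, ENNReal.ofReal (p n) :=
          Finset.sum_congr rfl fun n _ => (ofReal_measureReal (measure_ne_top _ _)).symm
      _ = ENNReal.ofReal (∑ n ∈ Finset.range N, p n) :=
          (ENNReal.ofReal_sum_of_nonneg fun n _ => hp0 n).symm
      _ ≤ _ := ENNReal.ofReal_le_ofReal (hS N)
  rw [FAR, ENNReal.inv_le_iff_inv_le, ← ENNReal.ofReal_inv_of_pos hα] at hF
  have h3 := (ENNReal.ofReal_le_ofReal_iff (by positivity)).1 (hF.trans hE)
  linarith

/-- Change of measure: on an event that is decided `k` observations after the change, and on which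
the log likelihood ratio is at most `C`, the laws with and without a change differ at most by the
factor `e ^ C`. -/
theorem path_le_exp_mul_pathInf {θ : Θ} (hD : m.D θ < ∞) (hD' : m.D' θ < ∞) {n₀ k : ℕ} {C : ℝ}
    {B : Set (ℕ → E)} (hB : MeasurableSet[past (n₀ + k)] B) :
    m.path θ (n₀ + 1) (B ∩ {ω | ∑ i ∈ Finset.Ioc n₀ (n₀ + k), m.llr θ (ω i) ≤ C})
      ≤ ENNReal.ofReal (Real.exp C) * m.pathInf B := by
  have hl := m.measurable_llr θ
  have hB' := past_le _ _ hB
  set T : Set (ℕ → E) := {ω | ∑ i ∈ Finset.Ioc n₀ (n₀ + k), m.llr θ (ω i) ≤ C} with hT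
  have hTm : MeasurableSet[past (n₀ + k)] T := by
    have h0 := fun i (hi : i ∈ Finset.Ioc n₀ (n₀ + k)) =>
      measurable_past_eval (E := E) (n := n₀ + k) (k := i)
        (by rw [Finset.mem_Ioc] at hi; omega) (by rw [Finset.mem_Ioc] at hi; omega)
    let _ := past (E := E) (n₀ + k)
    exact measurableSet_le (Finset.measurable_sum _ fun i hi => hl.comp (h0 i hi))
      measurable_const
  have hBT : MeasurableSet[past (n₀ + k)] (B ∩ T) :=
    @MeasurableSet.inter _ (past (n₀ + k)) _ _ hB hTm
  set r : E → ℝ≥0∞ := fun x => ENNReal.ofReal (Real.exp (m.llr θ x)) with hr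
  have hrm : Measurable r := by fun_prop
  have hP : m.P₀.withDensity r = m.P θ := (m.P_eq_withDensity_exp hD hD').symm
  have : IsProbabilityMeasure (m.P₀.withDensity r) := by rw [hP]; infer_instance
  have inst : ∀ i, IsProbabilityMeasure
      (if i ∈ Finset.Ioc n₀ (n₀ + k) then m.P₀.withDensity r else m.P₀) := fun i => by
    split_ifs <;> infer_instance
  have h1 := infinitePi_withDensity m.P₀ r hrm (Finset.Ioc n₀ (n₀ + k))
  have h2 : m.path θ (n₀ + 1) (B ∩ T)
      = (m.pathInf.withDensity fun ω => ∏ i ∈ Finset.Ioc n₀ (n₀ + k), r (ω i)) (B ∩ T) := by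
    rw [pathInf, h1]
    refine measure_infinitePi_congr _ _ (fun i hi1 hi2 => ?_) hBT
    rw [hP]
    by_cases h : i < n₀ + 1
    · rw [if_pos h, if_neg (by rw [Finset.mem_Ioc]; omega)]
    · rw [if_neg h, if_pos (by rw [Finset.mem_Ioc]; omega)]
  rw [h2, withDensity_apply _ (past_le _ _ hBT)]
  calc ∫⁻ ω in B ∩ T, ∏ i ∈ Finset.Ioc n₀ (n₀ + k), r (ω i) ∂m.pathInf
      ≤ ∫⁻ ω in B ∩ T, ENNReal.ofReal (Real.exp C) ∂m.pathInf := by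
        refine setLIntegral_mono measurable_const fun ω hω => ?_
        rw [← ENNReal.ofReal_prod_of_nonneg fun i _ => (Real.exp_pos _).le, ← Real.exp_sum]
        exact ENNReal.ofReal_le_ofReal (Real.exp_le_exp.2 hω.2)
    _ = ENNReal.ofReal (Real.exp C) * m.pathInf (B ∩ T) := setLIntegral_const _ _
    _ ≤ _ := by gcongr; exact Set.inter_subset_left

/-- The non-asymptotic form of the lower bound. The change point is placed at the beginning of a
block of `k` times that the stopping time survives with conditional pre-change probability at least
`1 - 2 k α`; the log likelihood ratio of the block exceeds `C` with probability `walkTail C k 0`. -/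
theorem le_CADD {θ : Θ} (hD : m.D θ < ∞) (hD' : m.D' θ < ∞) {Ψ : Policy E} (hΨ : Ψ.Admissible)
    {α : ℝ} (hα : 0 < α) (hF : m.FAR Ψ ≤ ENNReal.ofReal α) {k : ℕ} (hk : 0 < k) (C : ℝ) :
    ENNReal.ofReal (k * (1 - Real.exp C * (2 * k * α)
      - (walkTail (m.P θ) (m.llr θ) C k 0).toReal)) ≤ m.CADD θ Ψ := by
  have hk' : (0 : ℝ) < k := by exact_mod_cast hk
  obtain ⟨n₀, hn₀⟩ := m.exists_survival_block hΨ hα hF (k := k) (q := 2 * k * α) (by positivity)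
    (by
      rw [show (k : ℝ) / (2 * k * α) = α⁻¹ / 2 by field_simp]
      exact half_lt_self (inv_pos.2 hα))
  set Q := m.path θ (n₀ + 1) with hQ
  set δ := walkTail (m.P θ) (m.llr θ) C k 0 with hδ
  set B := {ω | (n₀ : ℕ∞) < Ψ.τ ω} with hB
  set G := {ω | ((n₀ + k : ℕ) : ℕ∞) < Ψ.τ ω} with hG
  have hBm : MeasurableSet[past n₀] B := hΨ.info_le _ _ (hΨ.measurableSet_lt n₀)
  have hGm : MeasurableSet[past (n₀ + k)] G := hΨ.info_le _ _ (hΨ.measurableSet_lt _)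
  have hGB : G ⊆ B := fun ω (hω : ((n₀ + k : ℕ) : ℕ∞) < Ψ.τ ω) =>
    lt_of_le_of_lt (by exact_mod_cast Nat.le_add_right n₀ k) hω
  have hBm' : MeasurableSet B := past_le _ _ hBm
  have hGm' : MeasurableSet G := past_le _ _ hGm
  have hBadm : MeasurableSet[past (n₀ + k)] (B \ G) :=
    @MeasurableSet.diff _ (past (n₀ + k)) _ _ (past_mono (Nat.le_add_right _ _) _ hBm) hGm
  have hQB : Q B = m.pathInf B :=
    measure_infinitePi_congr _ _ (fun i _ hi => if_pos (by omega)) hBm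
  have hQB' : Q.real B = m.pathInf.real B := by rw [Measure.real, hQB]; rfl
  have hBad : Q.real (B \ G) ≤ (Real.exp C * (2 * k * α) + δ.toReal) * Q.real B := by
    have h1 : Q (B \ G) ≤ ENNReal.ofReal (Real.exp C) * m.pathInf (B \ G) + δ * Q B := by
      have h2 := m.path_le_exp_mul_pathInf hD hD' (C := C) hBadm
      have h3 : Q ({ω | C < ∑ i ∈ Finset.Ioc n₀ (n₀ + k), m.llr θ (ω i)} ∩ B) = δ * Q B :=
        measure_sum_gt_inter (m.P θ) (m.measurable_llr θ) _
          (fun i hi => if_neg (by omega)) hBm C k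
      rw [← h3]
      refine (measure_mono fun ω hω => ?_).trans
        ((measure_union_le _ _).trans (add_le_add h2 le_rfl))
      rcases le_or_gt (∑ i ∈ Finset.Ioc n₀ (n₀ + k), m.llr θ (ω i)) C with h4 | h4
      · exact Or.inl ⟨hω, h4⟩
      · exact Or.inr ⟨h4, hω.1⟩
    have hδ1 : δ ≠ ∞ := by
      rw [hδ, walkTail_zero_eq (m.P θ) (m.measurable_llr θ)]
      exact measure_ne_top _ _
    have h5 := ENNReal.toReal_mono (by finiteness) h1
    rw [ENNReal.toReal_add (by finiteness) (by finiteness), ENNReal.toReal_mul,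
      ENNReal.toReal_mul, ENNReal.toReal_ofReal (Real.exp_pos C).le] at h5
    have h6 : m.pathInf.real (B \ G) ≤ 2 * k * α * Q.real B := by
      rw [measureReal_sdiff hGB hGm', hQB']
      linarith
    calc Q.real (B \ G) ≤ Real.exp C * m.pathInf.real (B \ G) + δ.toReal * Q.real B := h5
      _ ≤ Real.exp C * (2 * k * α * Q.real B) + δ.toReal * Q.real B := by gcongr
      _ = _ := by ring
  have hB0 : 0 < Q.real B := by
    have h1 : m.pathInf.real G ≤ m.pathInf.real B := measureReal_mono hGB
    have h2 : 0 ≤ m.pathInf.real B := measureReal_nonneg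
    rw [hQB']
    refine lt_of_le_of_ne h2 fun h0 => ?_
    rw [← h0, mul_zero] at hn₀
    linarith
  have hgood : (1 - Real.exp C * (2 * k * α) - δ.toReal) * Q.real B ≤ Q.real G := by
    rw [measureReal_sdiff hGB hGm'] at hBad
    linarith
  have e : {ω | ((n₀ + 1 : ℕ) : ℕ∞) ≤ Ψ.τ ω} = B := by
    ext ω
    rw [Set.mem_ofPred_eq, Nat.cast_add, Nat.cast_one,
      ENat.add_one_le_iff (ENat.natCast_ne_top n₀)]
    rfl
  refine le_trans ?_ (le_iSup₂ (f := fun (γ : ℕ) (_ : 1 ≤ γ) =>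
    ∫⁻ ω, ((Ψ.τ ω : ℝ≥0∞) - (γ : ℝ≥0∞))
      ∂(ProbabilityTheory.cond (m.path θ γ) {ω | (γ : ℕ∞) ≤ Ψ.τ ω})) (n₀ + 1) (by omega))
  rw [e, ProbabilityTheory.cond, lintegral_smul_measure, smul_eq_mul]
  have h1 : (k : ℝ≥0∞) * Q G ≤ ∫⁻ ω in B, ((Ψ.τ ω : ℝ≥0∞) - ((n₀ + 1 : ℕ) : ℝ≥0∞)) ∂Q := by
    rw [← setLIntegral_const]
    refine (setLIntegral_mono' hGm' fun ω hω => ?_).trans (lintegral_mono_set hGB)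
    have h2 : ((n₀ + k + 1 : ℕ) : ℕ∞) ≤ Ψ.τ ω := by
      rw [Nat.cast_add, Nat.cast_one]
      exact Order.add_one_le_of_lt hω
    have h3 : ((n₀ + k + 1 : ℕ) : ℝ≥0∞) ≤ (Ψ.τ ω : ℝ≥0∞) := by
      have := ENat.toENNReal_le.2 h2
      rwa [ENat.toENNReal_coe] at this
    calc (k : ℝ≥0∞) = ((n₀ + k + 1 : ℕ) : ℝ≥0∞) - ((n₀ + 1 : ℕ) : ℝ≥0∞) := by
          rw [← ENNReal.natCast_sub]; congr 1; omega
      _ ≤ _ := tsub_le_tsub_right h3 _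
  refine le_trans ?_ (mul_le_mul_right h1 _)
  have h4 : (Q B)⁻¹ * ((k : ℝ≥0∞) * Q G) = ENNReal.ofReal (k * (Q.real G / Q.real B)) := by
    rw [ENNReal.ofReal_mul hk'.le, ENNReal.ofReal_div_of_pos hB0,
      ofReal_measureReal (measure_ne_top _ _), ofReal_measureReal (measure_ne_top _ _),
      ENNReal.ofReal_natCast, div_eq_mul_inv]
    ring
  change _ ≤ (Q B)⁻¹ * ((k : ℝ≥0∞) * Q G)
  rw [h4]
  refine ENNReal.ofReal_le_ofReal (mul_le_mul_of_nonneg_left ?_ hk'.le)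
  rwa [le_div_iff₀ hB0]

end ChangeModel

/-! ### Asymptotics for small false alarm rates -/

section AsympEq

variable {ι : Type*} {l : Filter ι}

theorem AsympEq.of_forall_eventually {u : ι → ℝ≥0∞} {v : ι → ℝ} (hv : ∀ᶠ i in l, 0 < v i)
    (h₁ : ∀ ε : ℝ, 0 < ε → ε < 1 → ∀ᶠ i in l, ENNReal.ofReal ((1 - ε) * v i) ≤ u i)
    (h₂ : ∀ ε : ℝ, 0 < ε → ε < 1 → ∀ᶠ i in l, u i ≤ ENNReal.ofReal ((1 + ε) * v i)) :
    AsympEq l u fun i => ENNReal.ofReal (v i) := by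
  refine (ENNReal.tendsto_nhds ENNReal.one_ne_top).2 fun η hη => ?_
  obtain ⟨ε, hε0, hε1, hεη⟩ : ∃ ε : ℝ, 0 < ε ∧ ε < 1 ∧ ENNReal.ofReal ε ≤ η := by
    have hne : min η (1 / 2) ≠ ∞ := ne_top_of_le_ne_top (by simp) (min_le_right _ _)
    refine ⟨(min η (1 / 2)).toReal, ENNReal.toReal_pos (by simp [hη.ne']) hne, ?_, ?_⟩
    · have := ENNReal.toReal_mono (by simp) (min_le_right η (1 / 2))
      rw [ENNReal.toReal_div] at this
      refine this.trans_lt ?_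
      norm_num
    · rw [ENNReal.ofReal_toReal hne]
      exact min_le_left _ _
  filter_upwards [hv, h₁ ε hε0 hε1, h₂ ε hε0 hε1] with i hi h3 h4
  have hi0 : ENNReal.ofReal (v i) ≠ 0 := by simpa using hi
  constructor
  · rw [ENNReal.le_div_iff_mul_le (Or.inl hi0) (Or.inl ENNReal.ofReal_ne_top)]
    refine le_trans ?_ h3
    rw [ENNReal.ofReal_mul (by linarith), ENNReal.ofReal_sub _ hε0.le, ENNReal.ofReal_one]
    gcongr
  · rw [ENNReal.div_le_iff hi0 ENNReal.ofReal_ne_top]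
    refine h4.trans ?_
    rw [ENNReal.ofReal_mul (by linarith), ENNReal.ofReal_add zero_le_one hε0.le,
      ENNReal.ofReal_one]
    gcongr

theorem AsympEq.of_common {u w v : ι → ℝ≥0∞} (hu : AsympEq l u v) (hw : AsympEq l w v)
    (hv : ∀ᶠ i in l, v i ≠ 0 ∧ v i ≠ ∞) : AsympEq l u w := by
  have h := ENNReal.Tendsto.div hu (Or.inl one_ne_zero) hw (Or.inl ENNReal.one_ne_top)
  rw [div_one] at h
  refine h.congr' ?_
  filter_upwards [hv] with i hi
  rw [div_eq_mul_inv (u i), div_eq_mul_inv (w i),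
    ENNReal.mul_div_mul_right _ _ (ENNReal.inv_ne_zero.2 hi.2) (ENNReal.inv_ne_top.2 hi.1)]

end AsympEq

theorem tendsto_neg_log_nhdsGT_zero :
    Tendsto (fun α : ℝ => -Real.log α) (𝓝[>] 0) atTop :=
  tendsto_neg_atBot_atTop.comp Real.tendsto_log_nhdsGT_zero

/-- With `k = ⌈(1 - a) v / d⌉` and `C = (1 + a) d k`, the product `e ^ C * k` is of smaller order
than `e ^ v`, because `(1 + a) (1 - a) < 1`. -/
theorem tendsto_exp_mul_ceil {a d : ℝ} (ha0 : 0 < a) (ha1 : a < 1) (hd : 0 < d) :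
    Tendsto (fun v : ℝ => Real.exp ((1 + a) * d * ⌈(1 - a) * v / d⌉₊)
      * (2 * ⌈(1 - a) * v / d⌉₊ * Real.exp (-v))) atTop (𝓝 0) := by
  have ha2 : 0 < a ^ 2 := by positivity
  have h1 : Tendsto (fun v : ℝ => Real.exp ((1 + a) * d) * 2 *
      ((1 - a) / (d * a ^ 2) * ((a ^ 2 * v) ^ 1 * Real.exp (-(a ^ 2 * v)))
        + (a ^ 2 * v) ^ 0 * Real.exp (-(a ^ 2 * v)))) atTop
      (𝓝 (Real.exp ((1 + a) * d) * 2 * ((1 - a) / (d * a ^ 2) * 0 + 0))) := by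
    have hx : Tendsto (fun v : ℝ => a ^ 2 * v) atTop atTop := tendsto_id.const_mul_atTop ha2
    have e1 := (Real.tendsto_pow_mul_exp_neg_atTop_nhds_zero 1).comp hx
    have e0 := (Real.tendsto_pow_mul_exp_neg_atTop_nhds_zero 0).comp hx
    exact ((e1.const_mul _).add e0).const_mul _
  rw [mul_zero, add_zero, mul_zero] at h1
  refine squeeze_zero' (Eventually.of_forall fun v => by positivity) ?_ h1
  filter_upwards [eventually_ge_atTop 0] with v hv
  have hk : (⌈(1 - a) * v / d⌉₊ : ℝ) ≤ (1 - a) * v / d + 1 :=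
    (Nat.ceil_lt_add_one (div_nonneg (mul_nonneg (by linarith) hv) hd.le)).le
  have hC : (1 + a) * d * ⌈(1 - a) * v / d⌉₊ ≤ (1 + a) * d + (v - a ^ 2 * v) := by
    calc (1 + a) * d * ⌈(1 - a) * v / d⌉₊ ≤ (1 + a) * d * ((1 - a) * v / d + 1) := by gcongr
      _ = _ := by field_simp; ring
  calc _ ≤ Real.exp ((1 + a) * d + (v - a ^ 2 * v))
        * (2 * ((1 - a) * v / d + 1) * Real.exp (-v)) := by gcongr
    _ = Real.exp ((1 + a) * d) * 2 * (((1 - a) * v / d + 1)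
        * (Real.exp (v - a ^ 2 * v) * Real.exp (-v))) := by rw [Real.exp_add]; ring
    _ = _ := by
        rw [← Real.exp_add, show v - a ^ 2 * v + -v = -(a ^ 2 * v) by ring]
        field_simp

namespace ChangeModel

variable {E : Type*} [MeasurableSpace E] {Θ : Type*} (m : ChangeModel E Θ)

/-- The conditional average delay of every policy with false alarm rate at most `α` is at least
`(1 - o(1)) |log α| / D(f θ || f₀)`. -/
theorem eventually_le_CADD {θ : Θ} (hD : 0 < m.D θ ∧ m.D θ < ∞) (hD' : m.D' θ < ∞) {ε : ℝ}
    (hε0 : 0 < ε) (hε1 : ε < 1) :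
    ∀ᶠ α : ℝ in 𝓝[>] 0, ∀ Ψ : Policy E, Ψ.Admissible → m.FAR Ψ ≤ ENNReal.ofReal α →
      ENNReal.ofReal ((1 - ε) * (|Real.log α| / (m.D θ).toReal)) ≤ m.CADD θ Ψ := by
  set d := (m.D θ).toReal with hd'
  have hd : 0 < d := ENNReal.toReal_pos hD.1.ne' hD.2.ne
  set a := ε / 2 with ha
  have ha0 : 0 < a := by positivity
  have ha1 : a < 1 := by linarith
  set k : ℝ → ℕ := fun v => ⌈(1 - a) * v / d⌉₊ with hk
  have hk_top : Tendsto k atTop atTop := by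
    refine tendsto_nat_ceil_atTop.comp (Tendsto.atTop_div_const hd ?_)
    exact tendsto_id.const_mul_atTop (by linarith)
  have h1 := tendsto_exp_mul_ceil ha0 ha1 hd
  have h2 : Tendsto (fun v => (walkTail (m.P θ) (m.llr θ) ((1 + a) * d * k v) (k v) 0).toReal)
      atTop (𝓝 0) := by
    have h3 := tendsto_walkTail (m.P θ) (m.measurable_llr θ) (m.integrable_llr hD.2)
      (c := (1 + a) * d) (by rw [m.integral_llr hD.2]; nlinarith)
    exact (ENNReal.tendsto_toReal ENNReal.zero_ne_top).comp (h3.comp hk_top)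
  have h3 := h1.add h2
  rw [add_zero] at h3
  have h4 := (tendsto_neg_log_nhdsGT_zero.eventually (h3.eventually (gt_mem_nhds ha0))).and
    (tendsto_neg_log_nhdsGT_zero.eventually (eventually_gt_atTop 0))
  filter_upwards [h4, self_mem_nhdsWithin] with α hα hα0 Ψ hΨ hF
  have hα0' : 0 < α := hα0
  obtain ⟨hα1, hα2⟩ := hα
  set v := -Real.log α with hv
  have hexp : Real.exp (-v) = α := by rw [hv, neg_neg, Real.exp_log hα0']
  have habs : |Real.log α| = v := abs_of_neg (by linarith)
  have hkv : (1 - a) * v / d ≤ k v := Nat.le_ceil _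
  have hpos : 0 < (1 - a) * v / d := div_pos (mul_pos (by linarith) hα2) hd
  have hk0 : 0 < k v := Nat.ceil_pos.2 hpos
  refine le_trans ?_ (m.le_CADD hD.2 hD' hΨ hα0' hF hk0 ((1 + a) * d * k v))
  rw [hexp] at hα1
  change Real.exp ((1 + a) * d * k v) * (2 * k v * α) + _ < a at hα1
  refine ENNReal.ofReal_le_ofReal ?_
  rw [habs]
  calc (1 - ε) * (v / d) ≤ ((1 - a) * v / d) * (1 - a) := by
        rw [show (1 - a) * v / d * (1 - a) = (1 - a) ^ 2 * (v / d) by ring]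
        refine mul_le_mul_of_nonneg_right ?_ (div_pos hα2 hd).le
        nlinarith
    _ ≤ k v * (1 - a) := by gcongr
    _ ≤ _ := mul_le_mul_of_nonneg_left (by linarith) (Nat.cast_nonneg _)

theorem eventually_WADD_le [Finite Θ] {θ s : Θ} (hD : 0 < m.D θ ∧ m.D θ < ∞)
    (hs : m.LeastFavorable s) {μ : ℝ} (hμ : 0 < μ) {h : ℝ≥0∞} (hh : h < ∞) {M : ℝ} (hM : 1 ≤ M)
    {ε : ℝ} (hε0 : 0 < ε) :
    ∀ᶠ α : ℝ in 𝓝[>] 0, m.WADD θ (m.GDECuSum s μ h (Real.log (M / α)))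
      ≤ ENNReal.ofReal ((1 + ε) * (|Real.log α| / (m.D θ).toReal)) := by
  set d := (m.D θ).toReal with hd'
  have hd : 0 < d := ENNReal.toReal_pos hD.1.ne' hD.2.ne
  have h1 := tendsto_integral_min (m.P θ) (m.integrable_llr hD.2)
  rw [m.integral_llr hD.2] at h1
  -- the truncation level `c` is so high that the truncated drift is within `1 + ε` of the drift
  obtain ⟨c, hc, hc0⟩ := ((h1.eventually (lt_mem_nhds
    (show d / (1 + ε) < d from div_lt_self hd (by linarith)))).and (eventually_ge_atTop 0)).exists
  set dc := ∫ x, min (m.llr θ x) c ∂m.P θ with hdc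
  have hdc0 : 0 < dc := (div_pos hd (by linarith)).trans hc
  set K := (m.skipBound θ s μ h).toReal with hK
  have hKeq : m.skipBound θ s μ h = ENNReal.ofReal K :=
    (ENNReal.ofReal_toReal (m.skipBound_lt_top hs θ μ h).ne).symm
  have hslope : 0 < (1 + ε) / d - 1 / dc := by
    rw [sub_pos, div_lt_div_iff₀ hdc0 hd, one_mul]
    rw [div_lt_iff₀ (by linarith)] at hc
    linarith
  have h2 : ∀ᶠ v : ℝ in atTop, ((Real.log M + c) / dc + K) / ((1 + ε) / d - 1 / dc) ≤ v :=
    eventually_ge_atTop _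
  filter_upwards [tendsto_neg_log_nhdsGT_zero.eventually
    (h2.and (eventually_gt_atTop 0)), self_mem_nhdsWithin] with α hα hα0
  have hα0' : 0 < α := hα0
  obtain ⟨hα1, hα2⟩ := hα
  have hlogM : 0 ≤ Real.log M := Real.log_nonneg hM
  have hA : Real.log (M / α) = Real.log M + -Real.log α := by
    rw [Real.log_div (by linarith) hα0'.ne']; ring
  have hApos : 0 < Real.log (M / α) := by rw [hA]; linarith
  refine (m.WADD_GDECuSum_le θ s hD.2 hμ hh hApos hdc0).trans ?_
  rw [hKeq, ← ENNReal.ofReal_add (div_nonneg (by linarith) hdc0.le) ENNReal.toReal_nonneg]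
  refine ENNReal.ofReal_le_ofReal ?_
  rw [abs_of_neg (by linarith), hA]
  rw [div_le_iff₀ hslope] at hα1
  calc (Real.log M + -Real.log α + c) / dc + K
      = ((Real.log M + c) / dc + K) + -Real.log α * (1 / dc) := by ring
    _ ≤ -Real.log α * ((1 + ε) / d - 1 / dc) + -Real.log α * (1 / dc) := by gcongr
    _ = _ := by ring

end ChangeModel

end QCD

theorem corollary2 {E : Type*} [MeasurableSpace E] {M : ℕ} (m : QCD.ChangeModel E (Fin M))
    (hD : ∀ k, 0 < m.D k ∧ m.D k < ∞) (hD' : ∀ k, 0 < m.D' k ∧ m.D' k < ∞)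
    (s : Fin M) (hs : m.LeastFavorable s) :
    (∀ (μ : ℝ) (h : ℝ≥0∞), 0 < μ → ∀ α : ℝ, 0 < α → α < M →
      m.FAR (m.GDECuSum s μ h (Real.log (M / α))) ≤ m.FAR (m.GCuSum (Real.log (M / α))) ∧
      m.FAR (m.GCuSum (Real.log (M / α))) ≤ ENNReal.ofReal α ∧
      m.PDC (m.GDECuSum s μ h (Real.log (M / α))) = m.PDC (m.DECuSum s μ h (Real.log (M / α)))) ∧
    (∀ (μ : ℝ) (h : ℝ≥0∞), 0 < μ → h < ∞ → ∀ k : Fin M,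
      QCD.AsympEq (𝓝[>] (0 : ℝ))
        (fun α => m.WADD k (m.GDECuSum s μ h (Real.log (M / α))))
        (fun α => m.WADD k (m.GCuSum (Real.log (M / α)))) ∧
      QCD.AsympEq (𝓝[>] (0 : ℝ))
        (fun α => m.WADD k (m.GCuSum (Real.log (M / α))))
        (fun α => ENNReal.ofReal |Real.log α| / m.D k) ∧
      QCD.AsympEq (𝓝[>] (0 : ℝ))
        (fun α => m.WADD k (m.GDECuSum s μ h (Real.log (M / α))))
        (fun α => ENNReal.ofReal |Real.log α| / m.D k)) ∧
    (∀ β : ℝ, 0 < β → β ≤ 1 →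
      (∃ (μ : ℝ) (h : ℝ≥0∞), 0 < μ ∧ h < ∞ ∧ ∀ A : ℝ, m.PDC (m.DECuSum s μ h A) ≤ ENNReal.ofReal β) ∧
      ∀ (μ : ℝ) (h : ℝ≥0∞), 0 < μ → h < ∞ →
        (∀ A : ℝ, m.PDC (m.DECuSum s μ h A) ≤ ENNReal.ofReal β) →
        m.AsympOptimal m.CADD β (fun α => m.GDECuSum s μ h (Real.log (M / α))) ∧
        m.AsympOptimal m.WADD β (fun α => m.GDECuSum s μ h (Real.log (M / α)))) := by
  have : Nonempty (Fin M) := ⟨s⟩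
  have hM : (1 : ℝ) ≤ M := by exact_mod_cast Fin.pos s
  have hFAR : ∀ (μ : ℝ) (h : ℝ≥0∞) (α : ℝ), 0 < α → α < M →
      m.FAR (m.GDECuSum s μ h (Real.log (M / α))) ≤ m.FAR (m.GCuSum (Real.log (M / α))) ∧
      m.FAR (m.GCuSum (Real.log (M / α))) ≤ ENNReal.ofReal α := by
    intro μ h α h0 h1
    refine ⟨m.FAR_GDECuSum_le_FAR_GCuSum s μ h (Real.log_pos ((one_lt_div h0).2 h1)), ?_⟩
    have h2 := m.FAR_GCuSum_le (fun k => (hD k).2) (fun k => (hD' k).2) h0 (by simpa using h1)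
    simpa using h2
  have hlt1 : ∀ᶠ α : ℝ in 𝓝[>] 0, 0 < α ∧ α < 1 :=
    (eventually_mem_nhdsWithin).and (nhdsWithin_le_nhds (gt_mem_nhds zero_lt_one))
  set v : Fin M → ℝ → ℝ := fun k α => |Real.log α| / (m.D k).toReal with hv
  have hvpos : ∀ k, ∀ᶠ α : ℝ in 𝓝[>] 0, 0 < v k α := fun k => by
    filter_upwards [hlt1] with α hα
    exact div_pos (abs_pos.2 (Real.log_neg hα.1 hα.2).ne)
      (ENNReal.toReal_pos (hD k).1.ne' (hD k).2.ne)
  have hveq : ∀ k, (fun α => ENNReal.ofReal |Real.log α| / m.D k)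
      = fun α => ENNReal.ofReal (v k α) := fun k => by
    funext α
    rw [hv, ENNReal.ofReal_div_of_pos (ENNReal.toReal_pos (hD k).1.ne' (hD k).2.ne),
      ENNReal.ofReal_toReal (hD k).2.ne]
  have hvne : ∀ k, ∀ᶠ α : ℝ in 𝓝[>] 0,
      ENNReal.ofReal (v k α) ≠ 0 ∧ ENNReal.ofReal (v k α) ≠ ∞ := fun k => by
    filter_upwards [hvpos k] with α hα
    exact ⟨by simpa using hα, ENNReal.ofReal_ne_top⟩
  have hadm := fun μ h A => m.admissible_GDECuSum s μ h A
  have hFAR' : ∀ (μ : ℝ) (h : ℝ≥0∞) (α : ℝ), 0 < α → α < 1 →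
      m.FAR (m.GDECuSum s μ h (Real.log (M / α))) ≤ ENNReal.ofReal α := fun μ h α h0 h1 =>
    (hFAR μ h α h0 (h1.trans_le hM)).1.trans (hFAR μ h α h0 (h1.trans_le hM)).2
  have hGD : ∀ (μ : ℝ) (h : ℝ≥0∞), 0 < μ → h < ∞ → ∀ k,
      QCD.AsympEq (𝓝[>] (0 : ℝ)) (fun α => m.WADD k (m.GDECuSum s μ h (Real.log (M / α))))
        (fun α => ENNReal.ofReal (v k α)) := by
    intro μ h hμ hh k
    refine .of_forall_eventually (hvpos k) (fun ε h0 h1 => ?_)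
      (fun ε h0 _ => m.eventually_WADD_le (hD k) hs hμ hh hM h0)
    filter_upwards [hlt1, m.eventually_le_CADD (hD k) (hD' k).2 h0 h1] with α hα h2
    exact (h2 _ (hadm _ _ _) (hFAR' μ h α hα.1 hα.2)).trans (m.CADD_le_WADD k (hadm _ _ _))
  have hGDC : ∀ (μ : ℝ) (h : ℝ≥0∞), 0 < μ → h < ∞ → ∀ k,
      QCD.AsympEq (𝓝[>] (0 : ℝ)) (fun α => m.CADD k (m.GDECuSum s μ h (Real.log (M / α))))
        (fun α => ENNReal.ofReal (v k α)) := by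
    intro μ h hμ hh k
    refine .of_forall_eventually (hvpos k) (fun ε h0 h1 => ?_) (fun ε h0 _ => ?_)
    · filter_upwards [hlt1, m.eventually_le_CADD (hD k) (hD' k).2 h0 h1] with α hα h2
      exact h2 _ (hadm _ _ _) (hFAR' μ h α hα.1 hα.2)
    · filter_upwards [m.eventually_WADD_le (hD k) hs hμ hh hM h0] with α h2
      exact (m.CADD_le_WADD k (hadm _ _ _)).trans h2
  refine ⟨fun μ h hμ α h0 h1 => ⟨(hFAR μ h α h0 h1).1, (hFAR μ h α h0 h1).2, rfl⟩,
    fun μ h hμ hh k => ?_, fun β hβ0 _ => ⟨?_, fun μ h hμ hh hβ => ?_⟩⟩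
  · have h1 := hGD μ h hμ hh k
    have h2 := hGD 1 0 one_pos (by simp) k
    simp_rw [← m.GCuSum_eq_GDECuSum s 1] at h2
    rw [hveq]
    exact ⟨h1.of_common h2 (hvne k), h2, h1⟩
  · exact m.exists_PDC_DECuSum_le (hD s).2 (hD' s) hβ0
  · have hfeas : ∀ α, 0 < α → α < 1 →
        m.GDECuSum s μ h (Real.log (M / α)) ∈ m.feasible α β := fun α h0 h1 =>
      ⟨hadm _ _ _, hFAR' μ h α h0 h1, hβ (Real.log (M / α))⟩
    refine ⟨⟨hfeas, fun k => (hGDC μ h hμ hh k).of_common ?_ (hvne k)⟩,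
      ⟨hfeas, fun k => (hGD μ h hμ hh k).of_common ?_ (hvne k)⟩⟩
    · refine .of_forall_eventually (hvpos k) (fun ε h0 h1 => ?_) (fun ε h0 _ => ?_)
      · filter_upwards [m.eventually_le_CADD (hD k) (hD' k).2 h0 h1] with α h2
        exact le_iInf₂ fun Φ hΦ => h2 Φ hΦ.1 hΦ.2.1
      · filter_upwards [hlt1, m.eventually_WADD_le (hD k) hs hμ hh hM h0] with α hα h2
        exact (iInf₂_le _ (hfeas α hα.1 hα.2)).trans ((m.CADD_le_WADD k (hadm _ _ _)).trans h2)
    · refine .of_forall_eventually (hvpos k) (fun ε h0 h1 => ?_) (fun ε h0 _ => ?_)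
      · filter_upwards [m.eventually_le_CADD (hD k) (hD' k).2 h0 h1] with α h2
        exact le_iInf₂ fun Φ hΦ => (h2 Φ hΦ.1 hΦ.2.1).trans (m.CADD_le_WADD k hΦ.1)
      · filter_upwards [hlt1, m.eventually_WADD_le (hD k) hs hμ hh hM h0] with α hα h2
        exact (iInf₂_le _ (hfeas α hα.1 hα.2)).trans h2
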